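/- Let $R$ be a commutative ring. All functors are covariant functors on the category of commutative $R$-algebras, and $\mathcal R$ is the functor $\mathcal R(S)=S$. A functor of $\mathcal R$-modules $\mathbb M$ is a functor with a functorial $S$-module structure on each $\mathbb M(S)$. Its dual is $\mathbb M^*$, $\mathbb M^*(S)=\mathrm{Hom}_{\mathcal S}(\mathbb M_{|S},\mathcal S)$, where $|S$ denotes restriction to commutative $S$-algebras and $\mathcal S(T)=T$; tensor products are taken pointwise, $(\mathbb M\otimes\mathbb N)(S)=\mathbb M(S)\otimes_S\mathbb N(S)$. For an $R$-module (resp. an associative unital $R$-algebra) $A$, let $\mathcal A$ be the quasi-coherent module (resp. algebra) $S\mapsto S\otimes_RA$. Let $\mathfrak F$ be the family of the dual functors of $\mathcal R$-modules $\mathbb M\cong\mathbb N^*$ for which there are a set $J$, a structure of functor of $\prod_J\mathcal R$-modules on $\mathbb M$ and injective morphisms of functors of $\prod_J\mathcal R$-modules $\bigoplus_J\mathcal R\hookrightarrow\mathbb M\hookrightarrow\prod_J\mathcal R$ whose composite is the obvious inclusion. A functor of (associative unital) $\mathcal R$-algebras is *proquasi-coherent* if it is the inverse limit of its quasi-coherent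 algebra quotients. If $\mathbb A,\mathbb B\in\mathfrak F$ are proquasi-coherent algebras with quasi-coherent algebra quotients $\mathcal A_i$ and $\mathcal B_j$, then $\mathbb A\tilde\otimes\mathbb B:=(\mathbb A^*\otimes\mathbb B^*)^*=\varprojlim_{i,j}(\mathcal A_i^*\otimes\mathcal B_j^*)^*=\varprojlim_{i,j}(\mathcal A_i\otimes\mathcal B_j)$ carries the algebra structure of the limit. A *functor of proquasi-coherent bialgebras* in $\mathfrak F$ is a functor $\mathbb B\in\mathfrak F$ together with structures of functors of proquasi-coherent $\mathcal R$-algebras on $\mathbb B$ and on $\mathbb B^*$ such that the dual morphisms $\mathbb B=\mathbb B^{**}\to(\mathbb B^*\otimes\mathbb B^*)^*=\mathbb B\tilde\otimes\mathbb B$ and $\mathbb B=\mathbb B^{**}\to\mathcal R^*=\mathcal R$ of the multiplication and of the unit of $\mathbb B^*$ are morphisms of functors of $\mathcal R$-algebras. A morphism $\mathbb B\to\mathbb B'$ of such bialgebras is a morphism of functors of $\mathcal R$-modules $f$ such that $f$ and $f^*:\mathbb B'^*\to\mathbb B^*$ are morphisms of functors of $\mathcal R$-algebras. Let $\mathcal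 C$ be the resulting category. **Theorem.** For every $\mathbb B\in\mathcal C$ the natural morphism $\mathbb B\to\mathbb B^{**}$ is an isomorphism, and $\mathbb B^*$, with the given algebra structure on $\mathbb B^*$ and the algebra structure of $\mathbb B$ on $\mathbb B^{**}=\mathbb B$, is again an object of $\mathcal C$. The assignment $\mathbb B\mapsto\mathbb B^*$, $f\mapsto f^*$ is a functor $\mathcal C^{\mathrm{op}}\to\mathcal C$, and it is an equivalence of categories (that is, a categorical anti-equivalence of $\mathcal C$ with itself). -/

import Mathlib

open CategoryTheory TensorProduct

universe u v w v' w'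

noncomputable section

namespace RFunctor

/-- A functor of `𝓡`-modules: a covariant functor on commutative `R`-algebras, together with an
`S`-module structure on its value at each commutative `R`-algebra `S`, the transition maps being
semilinear. -/
structure ModFun (R : Type u) [CommRing R] where
  obj : CommAlgCat.{u} R → Type v
  [addCommGroup : ∀ S : CommAlgCat.{u} R, AddCommGroup (obj S)]
  [module : ∀ S : CommAlgCat.{u} R, Module S (obj S)]
  map : ∀ {S T : CommAlgCat.{u} R} (φ : S →ₐ[R] T), obj S →ₛₗ[(φ : S →+* T)] obj T
  map_id : ∀ (S : CommAlgCat.{u} R) (x : obj S), map (AlgHom.id R S) x = x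
  map_comp : ∀ {S T U : CommAlgCat.{u} R} (φ : S →ₐ[R] T) (ψ : T →ₐ[R] U) (x : obj S),
    map (ψ.comp φ) x = map ψ (map φ x)

attribute [instance] ModFun.addCommGroup ModFun.module

variable {R : Type u} [CommRing R]

/-- A morphism of functors of `𝓡`-modules. -/
@[ext]
structure Hom (M : ModFun.{u, v} R) (N : ModFun.{u, w} R) where
  app : ∀ S : CommAlgCat.{u} R, M.obj S →ₗ[S] N.obj S
  naturality : ∀ {S T : CommAlgCat.{u} R} (φ : S →ₐ[R] T) (x : M.obj S),
    app T (M.map φ x) = N.map φ (app S x)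

/-- The identity morphism. -/
def Hom.id (M : ModFun.{u, v} R) : Hom M M where
  app _ := LinearMap.id
  naturality _ _ := rfl

/-- The composite `g ∘ f`. -/
def Hom.comp {M : ModFun.{u, v} R} {N : ModFun.{u, w} R} {P : ModFun.{u, v'} R}
    (g : Hom N P) (f : Hom M N) : Hom M P where
  app S := (g.app S).comp (f.app S)
  naturality φ x := by simp [f.naturality, g.naturality]

/-- `f` is an isomorphism of functors. -/
def Hom.IsIso {M : ModFun.{u, v} R} {N : ModFun.{u, w} R} (f : Hom M N) : Prop :=
  ∀ S, Function.Bijective (f.app S)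

/-! ### Internal homs and duals -/

/-- `Hom_𝓢(M|_S, N|_S)`, as an additive group. A commutative `S`-algebra is a commutative
`R`-algebra `T` with a morphism `φ : S → T` of `R`-algebras, and a morphism of `S`-algebras from
`(T, φ)` to `(U, ψ ∘ φ)` is a morphism of `R`-algebras `ψ : T → U`. -/
def homOver (M : ModFun.{u, v} R) (N : ModFun.{u, w} R) (S : CommAlgCat.{u} R) :
    AddSubgroup (∀ (T : CommAlgCat.{u} R) (_ : S →ₐ[R] T), M.obj T →ₗ[T] N.obj T) where
  carrier := {f | ∀ (T U : CommAlgCat.{u} R) (φ : S →ₐ[R] T) (ψ : T →ₐ[R] U) (x : M.obj T),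
    f U (ψ.comp φ) (M.map ψ x) = N.map ψ (f T φ x)}
  add_mem' hf hg T U φ ψ x := by simp [hf T U φ ψ x, hg T U φ ψ x]
  zero_mem' T U φ ψ x := by simp
  neg_mem' hf T U φ ψ x := by simp [hf T U φ ψ x]

instance (M : ModFun.{u, v} R) (N : ModFun.{u, w} R) (S : CommAlgCat.{u} R) :
    SMul S (homOver M N S) where
  smul s f := ⟨fun T φ => φ s • f.1 T φ, fun T U φ ψ x => by simp [f.2 T U φ ψ x]⟩

lemma smul_val {M : ModFun.{u, v} R} {N : ModFun.{u, w} R} {S : CommAlgCat.{u} R} (s : S)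
    (f : homOver M N S) (T : CommAlgCat.{u} R) (φ : S →ₐ[R] T) :
    (s • f).1 T φ = φ s • f.1 T φ := rfl

instance (M : ModFun.{u, v} R) (N : ModFun.{u, w} R) (S : CommAlgCat.{u} R) :
    Module S (homOver M N S) where
  one_smul f := Subtype.ext <| by funext T φ; simp [smul_val]
  mul_smul s t f := Subtype.ext <| by funext T φ; simp [smul_val, mul_smul]
  smul_zero s := Subtype.ext <| by funext T φ; simp [smul_val]
  smul_add s f g := Subtype.ext <| by funext T φ; simp [smul_val]
  add_smul s t f := Subtype.ext <| by funext T φ; simp [smul_val, add_smul]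
  zero_smul f := Subtype.ext <| by funext T φ; simp [smul_val]

/-- The functor of `𝓡`-modules `ℍom_𝓡(M, N)`, `S ↦ Hom_𝓢(M|_S, N|_S)`. -/
def ihom (M : ModFun.{u, v} R) (N : ModFun.{u, w} R) : ModFun.{u, max (u + 1) v w} R where
  obj S := homOver M N S
  map φ :=
    { toFun := fun f => ⟨fun U χ => f.1 U (χ.comp φ), fun U V χ ψ x => f.2 U V (χ.comp φ) ψ x⟩
      map_add' := fun _ _ => rfl
      map_smul' := fun _ _ => rfl }
  map_id _ _ := rfl
  map_comp _ _ _ := rfl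

variable (R) in
/-- The functor `𝓡`, `S ↦ S`. -/
def unit : ModFun.{u, u} R where
  obj S := S
  map φ := { toFun := φ, map_add' := map_add φ, map_smul' := fun r x => map_mul φ r x }
  map_id _ _ := rfl
  map_comp _ _ _ := rfl

/-- The dual functor `M* = ℍom_𝓡(M, 𝓡)`. -/
def dual (M : ModFun.{u, v} R) : ModFun.{u, max (u + 1) v} R := ihom M (unit R)

/-- The dual morphism `f* : N* → M*` of `f : M → N`. -/
def dualMap {M : ModFun.{u, v} R} {N : ModFun.{u, w} R} (f : Hom M N) :
    Hom (dual N) (dual M) where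
  app S :=
    { toFun := fun g => ⟨fun T φ => (g.1 T φ).comp (f.app T), fun T U φ ψ x => by
        simpa [f.naturality] using g.2 T U φ ψ (f.app T x)⟩
      map_add' := fun _ _ => rfl
      map_smul' := fun _ _ => rfl }
  naturality _ _ := rfl

/-- The evaluation pairing `M*(S) → Hom_S(M(S), S)`, `f ↦ f_S`. -/
def ev (M : ModFun.{u, v} R) (S : CommAlgCat.{u} R) :
    (dual M).obj S →ₗ[S] (M.obj S →ₗ[S] S) where
  toFun f := f.1 S (AlgHom.id R S)
  map_add' _ _ := rfl
  map_smul' _ _ := rfl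

/-- Naturality of the evaluation pairing. -/
lemma ev_map (M : ModFun.{u, v} R) {S T : CommAlgCat.{u} R} (φ : S →ₐ[R] T)
    (f : (dual M).obj S) (x : M.obj S) :
    ev M T ((dual M).map φ f) (M.map φ x) = φ (ev M S f x) :=
  f.2 S T (AlgHom.id R S) φ x

/-- The natural morphism `M → M**`, `m ↦ (f ↦ f(m))`. -/
def bidual (M : ModFun.{u, v} R) : Hom M (dual (dual M)) where
  app S :=
    { toFun := fun m => ⟨fun T φ => (ev M T).flip (M.map φ m), fun T U φ ψ f => by
        have h := ev_map M ψ f (M.map φ m)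
        rw [← M.map_comp] at h
        exact h⟩
      map_add' := fun m n => Subtype.ext <| by
        funext T φ; ext f; exact (congrArg _ (map_add (M.map φ) m n)).trans (map_add (ev M T f) _ _)
      map_smul' := fun s m => Subtype.ext <| by
        funext T φ; ext f
        exact (congrArg _ ((M.map φ).map_smulₛₗ s m)).trans (map_smul (ev M T f) _ _) }
  naturality {S T} φ x := Subtype.ext <| by
    funext U χ
    exact congrArg (ev M U).flip (M.map_comp φ χ x).symm

/-! ### Tensor products and quasi-coherent modules -/

/-- The functor `M ⊗_𝓡 N`, `S ↦ M(S) ⊗_S N(S)`. -/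
def tensor (M : ModFun.{u, v} R) (N : ModFun.{u, w} R) : ModFun.{u, max v w} R where
  obj S := M.obj S ⊗[S] N.obj S
  map φ := TensorProduct.map (M.map φ) (N.map φ)
  map_id S x := by
    have hM : M.map (AlgHom.id R S) = LinearMap.id := LinearMap.ext (M.map_id S)
    have hN : N.map (AlgHom.id R S) = LinearMap.id := LinearMap.ext (N.map_id S)
    change TensorProduct.map (M.map (AlgHom.id R S)) (N.map (AlgHom.id R S)) x = x
    exact (congrArg₂ (fun f g => TensorProduct.map f g x) hM hN).trans
      (LinearMap.congr_fun TensorProduct.map_id x)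
  map_comp φ ψ x := by
    induction x with
    | zero => simp
    | tmul m n => simp [M.map_comp, N.map_comp]
    | add x y hx hy => simp only [map_add, hx, hy]

/-- The morphism `f ⊗ g`. -/
def tensorMap {M : ModFun.{u, v} R} {M' : ModFun.{u, v'} R} {N : ModFun.{u, w} R}
    {N' : ModFun.{u, w'} R} (f : Hom M M') (g : Hom N N') :
    Hom (tensor M N) (tensor M' N') where
  app S := TensorProduct.map (f.app S) (g.app S)
  naturality {S T} φ x := by
    change TensorProduct.map _ _ (TensorProduct.map _ _ x) =
      TensorProduct.map _ _ (TensorProduct.map _ _ x)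
    change M.obj S ⊗[S] N.obj S at x
    induction x with
    | zero => simp
    | tmul m n => simp [f.naturality, g.naturality]
    | add x y hx hy => simp only [map_add, hx, hy]

/-- `M ⊗~ N := (M* ⊗ N*)*`. -/
def ctensor (M : ModFun.{u, v} R) (N : ModFun.{u, w} R) : ModFun.{u, max (u + 1) v w} R :=
  dual (tensor (dual M) (dual N))

/-- The pairing `M*(S) ⊗ N*(S) → Hom_S(M(S) ⊗ N(S), S)`, `f ⊗ g ↦ (m ⊗ n ↦ f(m) g(n))`. -/
def evTensor (M : ModFun.{u, v} R) (N : ModFun.{u, w} R) (S : CommAlgCat.{u} R) :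
    (dual M).obj S ⊗[S] (dual N).obj S →ₗ[S] (M.obj S ⊗[S] N.obj S →ₗ[S] S) :=
  (TensorProduct.dualDistrib S (M.obj S) (N.obj S)).comp (TensorProduct.map (ev M S) (ev N S))

lemma evTensor_map (M : ModFun.{u, v} R) (N : ModFun.{u, w} R) {S T : CommAlgCat.{u} R}
    (φ : S →ₐ[R] T) (f : (tensor (dual M) (dual N)).obj S) (x : (tensor M N).obj S) :
    evTensor M N T ((tensor (dual M) (dual N)).map φ f) ((tensor M N).map φ x) =
      φ (evTensor M N S f x) := by
  change evTensor M N T (TensorProduct.map ((dual M).map φ) ((dual N).map φ) f)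
    (TensorProduct.map (M.map φ) (N.map φ) x) = φ (evTensor M N S f x)
  change (dual M).obj S ⊗[S] (dual N).obj S at f
  change M.obj S ⊗[S] N.obj S at x
  induction f with
  | zero => simp
  | add f g hf hg => simp only [map_add, LinearMap.add_apply, hf, hg]
  | tmul f g =>
    induction x with
    | zero => simp
    | add x y hx hy => simp only [map_add, hx, hy]
    | tmul m n => simp [evTensor, ev_map]

/-- The natural morphism `M ⊗ N → M ⊗~ N = (M* ⊗ N*)*`,
`m ⊗ n ↦ (f ⊗ g ↦ f(m) g(n))`. -/
def toCtensor (M : ModFun.{u, v} R) (N : ModFun.{u, w} R) :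
    Hom (tensor M N) (ctensor M N) where
  app S :=
    { toFun := fun x => ⟨fun T φ => (evTensor M N T).flip ((tensor M N).map φ x),
        fun T U φ ψ f => by
          have h := evTensor_map M N ψ f ((tensor M N).map φ x)
          rw [← (tensor M N).map_comp] at h
          exact h⟩
      map_add' := fun x y => Subtype.ext <| by
        funext T φ
        exact (congrArg _ (map_add ((tensor M N).map φ) x y)).trans (map_add _ _ _)
      map_smul' := fun s x => Subtype.ext <| by
        funext T φ
        exact (congrArg _ (((tensor M N).map φ).map_smulₛₗ s x)).trans (map_smul _ _ _) }
  naturality {S T} φ x := Subtype.ext <| by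
    funext U χ
    exact congrArg (evTensor M N U).flip ((tensor M N).map_comp φ χ x).symm

/-- The functorial morphism `(M* ⊗ N*)* → (M'* ⊗ N'*)*` induced by `f : M → M'`, `g : N → N'`. -/
def ctensorMap {M : ModFun.{u, v} R} {M' : ModFun.{u, v'} R} {N : ModFun.{u, w} R}
    {N' : ModFun.{u, w'} R} (f : Hom M M') (g : Hom N N') : Hom (ctensor M N) (ctensor M' N') :=
  dualMap (tensorMap (dualMap f) (dualMap g))

variable (R) in
/-- The quasi-coherent module associated with an `R`-module `A`: `S ↦ S ⊗_R A`. -/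
def qcoh (A : Type u) [AddCommGroup A] [Module R A] : ModFun.{u, u} R where
  obj S := S ⊗[R] A
  map {S T} φ :=
    { toFun := TensorProduct.map φ.toLinearMap (LinearMap.id : A →ₗ[R] A)
      map_add' := map_add _
      map_smul' := fun s x => by
        induction x with
        | zero => simp
        | tmul t a => simp [TensorProduct.smul_tmul']
        | add x y hx hy => simp only [smul_add, map_add, hx, hy] }
  map_id S x := LinearMap.congr_fun (TensorProduct.map_id (R := R) (M := S) (N := A)) x
  map_comp φ ψ x := by
    induction x with
    | zero => simp
    | tmul t a => simp
    | add x y hx hy => simp only [map_add, hx, hy]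

/-- The morphism of quasi-coherent modules associated with an `R`-linear map. -/
def qcohMap {A B : Type u} [AddCommGroup A] [Module R A] [AddCommGroup B] [Module R B]
    (f : A →ₗ[R] B) : Hom (qcoh R A) (qcoh R B) where
  app S := f.baseChange S
  naturality {S T} φ x := by
    change f.baseChange T (TensorProduct.map φ.toLinearMap LinearMap.id x) =
      TensorProduct.map φ.toLinearMap LinearMap.id (f.baseChange S x)
    change S ⊗[R] A at x
    induction x with
    | zero => simp
    | tmul t a => simp
    | add x y hx hy => simp only [map_add, hx, hy]

/-! ### Functors of algebras -/

/-- A structure of functor of `𝓡`-algebras (associative, with unit) on a functor of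
`𝓡`-modules. -/
structure AlgStr (M : ModFun.{u, v} R) where
  mul : ∀ S : CommAlgCat.{u} R, M.obj S →ₗ[S] M.obj S →ₗ[S] M.obj S
  one : ∀ S : CommAlgCat.{u} R, M.obj S
  mul_assoc : ∀ S (x y z : M.obj S), mul S (mul S x y) z = mul S x (mul S y z)
  one_mul : ∀ S (x : M.obj S), mul S (one S) x = x
  mul_one : ∀ S (x : M.obj S), mul S x (one S) = x
  map_mul : ∀ {S T : CommAlgCat.{u} R} (φ : S →ₐ[R] T) (x y : M.obj S),
    M.map φ (mul S x y) = mul T (M.map φ x) (M.map φ y)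
  map_one : ∀ {S T : CommAlgCat.{u} R} (φ : S →ₐ[R] T), M.map φ (one S) = one T

/-- `f` is a morphism of functors of `𝓡`-algebras. -/
structure IsAlgHom {M : ModFun.{u, v} R} {N : ModFun.{u, w} R} (a : AlgStr M) (b : AlgStr N)
    (f : Hom M N) : Prop where
  map_mul : ∀ S (x y : M.obj S), f.app S (a.mul S x y) = b.mul S (f.app S x) (f.app S y)
  map_one : ∀ S, f.app S (a.one S) = b.one S

/-- The multiplication morphism `M ⊗ M → M`. -/
def AlgStr.mulHom {M : ModFun.{u, v} R} (a : AlgStr M) : Hom (tensor M M) M where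
  app S := TensorProduct.lift (a.mul S)
  naturality {S T} φ x := by
    change TensorProduct.lift (a.mul T) (TensorProduct.map (M.map φ) (M.map φ) x) =
      M.map φ (TensorProduct.lift (a.mul S) x)
    change M.obj S ⊗[S] M.obj S at x
    induction x with
    | zero => simp
    | tmul m n => simp [a.map_mul]
    | add x y hx hy => simp only [map_add, hx, hy]

/-- The unit morphism `𝓡 → M`. -/
def AlgStr.unitHom {M : ModFun.{u, v} R} (a : AlgStr M) : Hom (unit R) M where
  app S := LinearMap.toSpanSingleton S (M.obj S) (a.one S)
  naturality {S T} φ x := by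
    change φ x • a.one T = M.map φ ((show S from x) • a.one S)
    rw [(M.map φ).map_smulₛₗ, a.map_one]
    rfl

variable (R) in
/-- The functor of algebras `𝓡`. -/
def unitAlg : AlgStr (unit R) where
  mul S := LinearMap.mul S S
  one S := (1 : S)
  mul_assoc S := _root_.mul_assoc (G := S)
  one_mul S := _root_.one_mul (M := S)
  mul_one S := _root_.mul_one (M := S)
  map_mul φ := _root_.map_mul φ
  map_one φ := _root_.map_one φ

variable (R) in
/-- The quasi-coherent algebra associated with an `R`-algebra `A`. -/
def qcohAlg (A : Type u) [Ring A] [Algebra R A] : AlgStr (qcoh R A) where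
  mul S := LinearMap.mul S (S ⊗[R] A)
  one S := (1 : S ⊗[R] A)
  mul_assoc S := _root_.mul_assoc (G := S ⊗[R] A)
  one_mul S := _root_.one_mul (M := S ⊗[R] A)
  mul_one S := _root_.mul_one (M := S ⊗[R] A)
  map_mul φ := _root_.map_mul (Algebra.TensorProduct.map φ (AlgHom.id R A))
  map_one φ := _root_.map_one (Algebra.TensorProduct.map φ (AlgHom.id R A))

variable (R) in
/-- The tensor product of two quasi-coherent algebras, a functor of `𝓡`-algebras. -/
def qcohTensorAlg (A B : Type u) [Ring A] [Algebra R A] [Ring B] [Algebra R B] :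
    AlgStr (tensor (qcoh R A) (qcoh R B)) where
  mul S := LinearMap.mul S ((S ⊗[R] A) ⊗[S] (S ⊗[R] B))
  one S := (1 : (S ⊗[R] A) ⊗[S] (S ⊗[R] B))
  mul_assoc S := _root_.mul_assoc (G := (S ⊗[R] A) ⊗[S] (S ⊗[R] B))
  one_mul S := _root_.one_mul (M := (S ⊗[R] A) ⊗[S] (S ⊗[R] B))
  mul_one S := _root_.mul_one (M := (S ⊗[R] A) ⊗[S] (S ⊗[R] B))
  map_mul {S T} φ x y := by
    have hA : ∀ a b : S ⊗[R] A, (qcoh R A).map φ (a * b) =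
        (show T ⊗[R] A from (qcoh R A).map φ a) * (show T ⊗[R] A from (qcoh R A).map φ b) :=
      (qcohAlg R A).map_mul φ
    have hB : ∀ a b : S ⊗[R] B, (qcoh R B).map φ (a * b) =
        (show T ⊗[R] B from (qcoh R B).map φ a) * (show T ⊗[R] B from (qcoh R B).map φ b) :=
      (qcohAlg R B).map_mul φ
    let F : (S ⊗[R] A) ⊗[S] (S ⊗[R] B) →+ (T ⊗[R] A) ⊗[T] (T ⊗[R] B) :=
      (TensorProduct.map ((qcoh R A).map φ) ((qcoh R B).map φ)).toAddMonoidHom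
    have hF : ∀ (a : S ⊗[R] A) (b : S ⊗[R] B), F (a ⊗ₜ[S] b) =
        (show T ⊗[R] A from (qcoh R A).map φ a) ⊗ₜ[T]
          (show T ⊗[R] B from (qcoh R B).map φ b) := fun _ _ => rfl
    suffices h : ∀ x y : (S ⊗[R] A) ⊗[S] (S ⊗[R] B), F (x * y) = F x * F y from h x y
    clear x y
    intro x y
    induction x with
    | zero => simp
    | add x x' hx hx' => rw [_root_.add_mul, map_add, hx, hx', map_add, _root_.add_mul]
    | tmul a b =>
      induction y with
      | zero => simp
      | add y y' hy hy' => rw [_root_.mul_add, map_add, hy, hy', map_add, _root_.mul_add]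
      | tmul c d =>
        rw [Algebra.TensorProduct.tmul_mul_tmul, hF, hF, hF, hA, hB,
          Algebra.TensorProduct.tmul_mul_tmul]
  map_one {S T} φ := by
    change (show T ⊗[R] A from (qcoh R A).map φ (1 : S ⊗[R] A)) ⊗ₜ[T]
      (show T ⊗[R] B from (qcoh R B).map φ (1 : S ⊗[R] B)) = _
    exact congrArg₂ (fun (a : T ⊗[R] A) (b : T ⊗[R] B) => a ⊗ₜ[T] b)
      ((qcohAlg R A).map_one φ) ((qcohAlg R B).map_one φ)

/-- A quasi-coherent algebra quotient of a functor of algebras `(M, a)`. -/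
structure QCohAlgQuot {M : ModFun.{u, v} R} (a : AlgStr M) where
  A : Type u
  [ring : Ring A]
  [algebra : Algebra R A]
  proj : Hom M (qcoh R A)
  isAlgHom : IsAlgHom a (qcohAlg R A) proj
  surjective : ∀ S, Function.Surjective (proj.app S)

attribute [instance] QCohAlgQuot.ring QCohAlgQuot.algebra

/-- `(M, a)` is a functor of proquasi-coherent algebras: it is the inverse limit of its
quasi-coherent algebra quotients, i.e. for every `S` the natural map from `M(S)` to the set of
families of elements of the `S ⊗ A` (one for each quotient `M → 𝓐`) that are compatible with all
morphisms of quotients of `M` is bijective. -/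
def IsProquasiCoherent {M : ModFun.{u, v} R} (a : AlgStr M) : Prop :=
  ∀ (S : CommAlgCat.{u} R) (x : ∀ Q : QCohAlgQuot a, (qcoh R Q.A).obj S),
    (∀ (Q Q' : QCohAlgQuot a) (f : Q.A →ₐ[R] Q'.A),
      (qcohMap f.toLinearMap).comp Q.proj = Q'.proj →
        (qcohMap f.toLinearMap).app S (x Q) = x Q') →
    ∃! m : M.obj S, ∀ Q : QCohAlgQuot a, Q.proj.app S m = x Q

/-- `t` is the algebra structure of `M ⊗~ N = (M* ⊗ N*)*`, for functors of proquasi-coherent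
algebras `M = lim 𝓐ᵢ`, `N = lim 𝓑ⱼ` (limits over the quasi-coherent algebra quotients): the one
given by `(M* ⊗ N*)* = lim (𝓐ᵢ* ⊗ 𝓑ⱼ*)* = lim (𝓐ᵢ ⊗ 𝓑ⱼ)`. That is, each of the projections
`(M* ⊗ N*)* → (𝓐ᵢ* ⊗ 𝓑ⱼ*)* = 𝓐ᵢ ⊗ 𝓑ⱼ` is a morphism of functors of algebras. -/
def IsCtensorAlg {M N : ModFun.{u, v} R} (a : AlgStr M) (b : AlgStr N)
    (t : AlgStr (ctensor M N)) : Prop :=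
  ∀ (P : QCohAlgQuot a) (Q : QCohAlgQuot b),
    ∃ π : Hom (ctensor M N) (tensor (qcoh R P.A) (qcoh R Q.A)),
      (toCtensor (qcoh R P.A) (qcoh R Q.A)).comp π = ctensorMap P.proj Q.proj ∧
      IsAlgHom t (qcohTensorAlg R P.A Q.A) π

/-! ### The family `𝔉` -/

variable (R) in
/-- The functor `∏_J 𝓡`. -/
def prodUnit (J : Type u) : ModFun.{u, u} R where
  obj S := J → S
  map {S T} φ :=
    { toFun := fun x j => φ (x j)
      map_add' := fun x y => by funext j; simp
      map_smul' := fun s x => by funext j; simp }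
  map_id _ _ := rfl
  map_comp _ _ _ := rfl

/-- `M` is a dual functor. -/
def IsDual (M : ModFun.{u, u + 1} R) : Prop :=
  ∃ (N : ModFun.{u, u + 1} R) (e : Hom M (dual N)), e.IsIso

/-- The family `𝔉`: the dual functors `M` for which there are a set `J` and inclusions
`⊕_J 𝓡 ⊆ M ⊆ ∏_J 𝓡` of functors of `∏_J 𝓡`-modules, i.e. `M` is isomorphic to a subfunctor of
`𝓡`-modules of `∏_J 𝓡` which contains `⊕_J 𝓡` and is stable under (componentwise) multiplication
by `∏_J 𝓡`. -/
def InF (M : ModFun.{u, u + 1} R) : Prop :=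
  IsDual M ∧ ∃ (J : Type u) (ι : Hom M (prodUnit R J)),
    (∀ S, Function.Injective (ι.app S)) ∧
    (∀ (S : CommAlgCat.{u} R) (x : J → S), x.support.Finite → ∃ m, ι.app S m = x) ∧
    (∀ (S : CommAlgCat.{u} R) (c : J → S) (m : M.obj S),
      ∃ m', ι.app S m' = fun j => c j * (show J → S from ι.app S m) j)

/-! ### Functors of proquasi-coherent bialgebras -/

/-- The dual morphism `M = M** → (M* ⊗ M*)* = M ⊗~ M` of the multiplication morphism
of `M*`. -/
def comul {M : ModFun.{u, v} R} (d : AlgStr (dual M)) : Hom M (ctensor M M) :=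
  (dualMap d.mulHom).comp (bidual M)

variable (R) in
/-- The identification `𝓡* = 𝓡`, `f ↦ f(1)`. -/
def dualUnit : Hom (dual (unit R)) (unit R) where
  app S := (ev (unit R) S).flip (1 : S)
  naturality {S T} φ f := by
    exact (congrArg (ev (unit R) T ((dual (unit R)).map φ f)) (map_one φ).symm).trans
      (ev_map (unit R) φ f (1 : S))

/-- The dual morphism `M = M** → 𝓡* = 𝓡` of the unit morphism of `M*`. -/
def counit {M : ModFun.{u, v} R} (d : AlgStr (dual M)) : Hom M (unit R) :=
  (dualUnit R).comp ((dualMap d.unitHom).comp (bidual M))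

variable (R) in
/-- A functor of proquasi-coherent bialgebras in `𝔉`. -/
structure Bialg where
  carrier : ModFun.{u, u + 1} R
  /-- The algebra structure of `𝔹`. -/
  alg : AlgStr carrier
  /-- The algebra structure of `𝔹*`. -/
  dualAlg : AlgStr (dual carrier)
  inF : InF carrier
  proquasiCoherent : IsProquasiCoherent alg
  dual_proquasiCoherent : IsProquasiCoherent dualAlg
  /-- The dual of the multiplication of `𝔹*` is a morphism of functors of algebras. -/
  comul_isAlgHom : ∃ t : AlgStr (ctensor carrier carrier),
    IsCtensorAlg alg alg t ∧ IsAlgHom alg t (comul dualAlg)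
  /-- The dual of the unit of `𝔹*` is a morphism of functors of algebras. -/
  counit_isAlgHom : IsAlgHom alg (unitAlg R) (counit dualAlg)

/-- A morphism of functors of bialgebras. -/
@[ext]
structure Bialg.Hom (B C : Bialg R) where
  hom : RFunctor.Hom B.carrier C.carrier
  isAlgHom : IsAlgHom B.alg C.alg hom
  dual_isAlgHom : IsAlgHom C.dualAlg B.dualAlg (dualMap hom)

lemma IsAlgHom.id {M : ModFun.{u, v} R} (a : AlgStr M) : IsAlgHom a a (Hom.id M) :=
  ⟨fun _ _ _ => rfl, fun _ => rfl⟩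

lemma IsAlgHom.comp {M : ModFun.{u, v} R} {N : ModFun.{u, w} R} {P : ModFun.{u, v'} R}
    {a : AlgStr M} {b : AlgStr N} {c : AlgStr P} {g : Hom N P} {f : Hom M N}
    (hg : IsAlgHom b c g) (hf : IsAlgHom a b f) : IsAlgHom a c (g.comp f) where
  map_mul S x y := by simp [Hom.comp, hf.map_mul, hg.map_mul]
  map_one S := by simp [Hom.comp, hf.map_one, hg.map_one]

/-- The category of functors of proquasi-coherent bialgebras in `𝔉`. -/
instance : Category (Bialg R) where
  Hom B C := Bialg.Hom B C
  id B := ⟨Hom.id B.carrier, .id _, .id _⟩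
  comp f g := ⟨g.hom.comp f.hom, g.isAlgHom.comp f.isAlgHom,
    f.dual_isAlgHom.comp g.dual_isAlgHom⟩

/-- `e` identifies the bialgebra `C` with the bialgebra `𝔹*`: it is an isomorphism from `C` to
`𝔹*` under which the algebra structure of `C` is the one of `𝔹*`, and `𝔹 → 𝔹** → C*` is an
isomorphism under which the algebra structure of `C*` is the one of `𝔹`. -/
structure IsDualBialg (B C : Bialg R) (e : Hom C.carrier (dual B.carrier)) : Prop where
  isIso : e.IsIso
  isAlgHom : IsAlgHom C.alg B.dualAlg e
  bidual_isIso : (bidual B.carrier).IsIso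
  dual_isAlgHom : IsAlgHom B.alg C.dualAlg ((dualMap e).comp (bidual B.carrier))

end RFunctor

end

noncomputable section

namespace RFunctor

variable {R : Type u} [CommRing R]

/-! ### Evaluation of functionals -/

/-! Two facts carry the theorem: members of 𝔉 are reflexive with duals again in 𝔉, and the bialgebra
axioms are symmetric in 𝔹 and 𝔹*. Given these, 𝔹 → 𝔹** makes duality its own quasi-inverse.

Reflexivity starts from quasi-coherent modules. A morphism 𝓐* → 𝓑 over S is determined by its value
at the generic functional, which lives over the square-zero extension S ⊕ (S ⊗ A)
(`exists_tensor_of_hom`). Hence 𝓐** = 𝓐 and (𝓐* ⊗ 𝓑*)* = 𝓐 ⊗ 𝓑. Taking 𝓐 = ⊕_J 𝓡, functionals on ∏_J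
𝓡 are finite combinations of coordinates. If M lies between ⊕_J 𝓡 and ∏_J 𝓡 and is stable under ∏_J
𝓡, then c ↦ f(c·x) is such a functional, so f(x) = Σ x_j f(e_j) with finitely many nonzero terms
(`exists_frame`). Coordinates of the same kind then exist on M*, and on (M ⊗ N)* when N is of this
kind too (`Expansion.exists_frame_dual`, `Frame.tensor`). A dual functor with such coordinates is
reflexive (`Frame.bidual_isIso`).

For the symmetry, the product of M ⊗~ M is computed from the products of the e_i ⊗ e_j
(`IsCtensorAlg.ev_mul`). Multiplicativity of the comultiplication becomes ⟨f g, x y⟩ = Σ ⟨e_i* e_j*,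
x⟩ ⟨e_k* e_l*, y⟩ ⟨f, e_i e_k⟩ ⟨g, e_j e_l⟩, which is unchanged when M and M* are exchanged and j, k
are swapped (`Compatible.dual`). Of the three identities involving units, two are exchanged and one
is self-dual. The algebra structure needed on 𝔹* ⊗~ 𝔹* is glued from the 𝓐ᵢ ⊗ 𝓑ⱼ
(`exists_isCtensorAlg`). -/

@[simp]
lemma Hom.comp_app {M : ModFun.{u, v} R} {N : ModFun.{u, w} R} {P : ModFun.{u, v'} R}
    (g : Hom N P) (f : Hom M N) (S : CommAlgCat.{u} R) (x : M.obj S) :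
    (g.comp f).app S x = g.app S (f.app S x) := rfl

lemma Hom.ext_app {M : ModFun.{u, v} R} {N : ModFun.{u, w} R} {f g : Hom M N}
    (h : ∀ S x, f.app S x = g.app S x) : f = g :=
  Hom.ext (funext fun S => LinearMap.ext (h S))

lemma Hom.congr_app {M : ModFun.{u, v} R} {N : ModFun.{u, w} R} {f g : Hom M N} (h : f = g)
    (S : CommAlgCat.{u} R) (x : M.obj S) : f.app S x = g.app S x := by rw [h]

/-- A functional over `S` from a compatible family of linear forms. -/
def ofEv (M : ModFun.{u, v} R) {S : CommAlgCat.{u} R}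
    (b : ∀ (T : CommAlgCat.{u} R) (_ : S →ₐ[R] T), M.obj T →ₗ[T] T)
    (h : ∀ (T U : CommAlgCat.{u} R) (φ : S →ₐ[R] T) (ψ : T →ₐ[R] U) (x : M.obj T),
      b U (ψ.comp φ) (M.map ψ x) = ψ (b T φ x)) : (dual M).obj S :=
  ⟨b, h⟩

lemma dual_ext {M : ModFun.{u, v} R} {S : CommAlgCat.{u} R} {f g : (dual M).obj S}
    (h : ∀ (T : CommAlgCat.{u} R) (φ : S →ₐ[R] T) (x : M.obj T),
      ev M T ((dual M).map φ f) x = ev M T ((dual M).map φ g) x) : f = g :=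
  Subtype.ext (funext fun T => funext fun φ => LinearMap.ext (h T φ))

@[simp]
lemma ev_dualMap {M : ModFun.{u, v} R} {N : ModFun.{u, w} R} (f : Hom M N)
    {S : CommAlgCat.{u} R} (g : (dual N).obj S) (x : M.obj S) :
    ev M S ((dualMap f).app S g) x = ev N S g (f.app S x) := rfl

@[simp]
lemma ev_bidual {M : ModFun.{u, v} R} {S : CommAlgCat.{u} R} (x : M.obj S)
    (f : (dual M).obj S) : ev (dual M) S ((bidual M).app S x) f = ev M S f x :=
  congrArg (ev M S f) (M.map_id S x)

@[simp]
lemma ev_toCtensor {M : ModFun.{u, v} R} {N : ModFun.{u, w} R} {S : CommAlgCat.{u} R}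
    (x : M.obj S) (y : N.obj S) (f : (dual M).obj S) (g : (dual N).obj S) :
    ev (tensor (dual M) (dual N)) S ((toCtensor M N).app S (x ⊗ₜ[S] y)) (f ⊗ₜ[S] g) =
      ev M S f x * ev N S g y :=
  congrArg₂ (fun x y => ev M S f x * ev N S g y) (M.map_id S x) (N.map_id S y)

lemma ev_toCtensor_eq {M : ModFun.{u, v} R} {N : ModFun.{u, w} R} {S : CommAlgCat.{u} R}
    (x : M.obj S ⊗[S] N.obj S) (f : (dual M).obj S ⊗[S] (dual N).obj S) :
    ev (tensor (dual M) (dual N)) S ((toCtensor M N).app S x) f = evTensor M N S f x :=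
  congrArg (evTensor M N S f) ((tensor M N).map_id S x)

@[simp]
lemma ev_ctensorMap {M : ModFun.{u, v} R} {M' : ModFun.{u, v'} R} {N : ModFun.{u, w} R}
    {N' : ModFun.{u, w'} R} (f : Hom M M') (g : Hom N N') {S : CommAlgCat.{u} R}
    (s : (ctensor M N).obj S) (x : (dual M').obj S) (y : (dual N').obj S) :
    ev (tensor (dual M') (dual N')) S ((ctensorMap f g).app S s) (x ⊗ₜ[S] y) =
      ev (tensor (dual M) (dual N)) S s ((dualMap f).app S x ⊗ₜ[S] (dualMap g).app S y) := rfl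

@[simp]
lemma ev_comul {M : ModFun.{u, v} R} (d : AlgStr (dual M)) {S : CommAlgCat.{u} R} (x : M.obj S)
    (f g : (dual M).obj S) :
    ev (tensor (dual M) (dual M)) S ((comul d).app S x) (f ⊗ₜ[S] g) = ev M S (d.mul S f g) x :=
  ev_bidual x (d.mul S f g)

@[simp]
lemma counit_app {M : ModFun.{u, v} R} (d : AlgStr (dual M)) {S : CommAlgCat.{u} R}
    (x : M.obj S) : (counit d).app S x = ev M S (d.one S) x :=
  (ev_bidual x ((1 : S) • d.one S)).trans (by rw [one_smul])

lemma tensor_dual_ext {M : ModFun.{u, v} R} {N : ModFun.{u, w} R} {S : CommAlgCat.{u} R}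
    {s t : (dual (tensor M N)).obj S}
    (h : ∀ (T : CommAlgCat.{u} R) (φ : S →ₐ[R] T) (x : M.obj T) (y : N.obj T),
      ev (tensor M N) T ((dual (tensor M N)).map φ s) (x ⊗ₜ[T] y) =
        ev (tensor M N) T ((dual (tensor M N)).map φ t) (x ⊗ₜ[T] y)) : s = t :=
  dual_ext fun T φ => LinearMap.congr_fun (TensorProduct.ext' (h T φ))

/-- A functional on `M ⊗ N` over `S` from a compatible family of bilinear forms. -/
def ofBilin (M : ModFun.{u, v} R) (N : ModFun.{u, w} R) {S : CommAlgCat.{u} R}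
    (b : ∀ (T : CommAlgCat.{u} R) (_ : S →ₐ[R] T), M.obj T →ₗ[T] N.obj T →ₗ[T] T)
    (h : ∀ (T U : CommAlgCat.{u} R) (φ : S →ₐ[R] T) (ψ : T →ₐ[R] U) (x : M.obj T) (y : N.obj T),
      b U (ψ.comp φ) (M.map ψ x) (N.map ψ y) = ψ (b T φ x y)) : (dual (tensor M N)).obj S :=
  ofEv (tensor M N) (fun T φ => TensorProduct.lift (b T φ)) fun T U φ ψ x => by
    suffices H : ∀ x : M.obj T ⊗[T] N.obj T,
        TensorProduct.lift (b U (ψ.comp φ)) (TensorProduct.map (M.map ψ) (N.map ψ) x) =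
          ψ (TensorProduct.lift (b T φ) x) from H x
    intro x
    induction x with
    | zero => simp
    | tmul x y => simpa using h T U φ ψ x y
    | add x y hx hy => simp only [map_add, hx, hy]

/-- The functional `y ↦ s (x ⊗ y)`. -/
def evalLeft {M : ModFun.{u, v} R} {N : ModFun.{u, w} R} {S : CommAlgCat.{u} R}
    (s : (dual (tensor M N)).obj S) : M.obj S →ₗ[S] (dual N).obj S where
  toFun x := ofEv N
    (fun T φ => (ev (tensor M N) T ((dual (tensor M N)).map φ s)).comp
      (TensorProduct.mk T (M.obj T) (N.obj T) (M.map φ x)))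
    (fun T U φ ψ y => by
      have h := ev_map (tensor M N) ψ ((dual (tensor M N)).map φ s) (M.map φ x ⊗ₜ[T] y)
      have h' : (tensor M N).map ψ (M.map φ x ⊗ₜ[T] y) =
        M.map (ψ.comp φ) x ⊗ₜ[U] N.map ψ y := by
          rw [M.map_comp]; rfl
      rw [h'] at h
      exact h)
  map_add' x x' := dual_ext fun T φ y =>
    (congrArg (ev (tensor M N) T ((dual (tensor M N)).map φ s)) <| by
      rw [map_add]; exact TensorProduct.add_tmul _ _ _).trans (map_add _ _ _)
  map_smul' r x := dual_ext fun T φ y =>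
    (congrArg (fun z => ev (tensor M N) T ((dual (tensor M N)).map φ s) (z ⊗ₜ[T] y))
      ((M.map φ).map_smulₛₗ r x)).trans
        (map_smul (ev (tensor M N) T ((dual (tensor M N)).map φ s)) (φ r) (M.map φ x ⊗ₜ[T] y))

@[simp]
lemma ev_evalLeft {M : ModFun.{u, v} R} {N : ModFun.{u, w} R} {S : CommAlgCat.{u} R}
    (s : (dual (tensor M N)).obj S) (x : M.obj S) (y : N.obj S) :
    ev N S (evalLeft s x) y = ev (tensor M N) S s (x ⊗ₜ[S] y) :=
  congrArg (fun x => ev (tensor M N) S s (x ⊗ₜ[S] y)) (M.map_id S x)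

/-- The functional `x ↦ s (x ⊗ y)`. -/
def evalRight {M : ModFun.{u, v} R} {N : ModFun.{u, w} R} {S : CommAlgCat.{u} R}
    (s : (dual (tensor M N)).obj S) : N.obj S →ₗ[S] (dual M).obj S where
  toFun y := ofEv M
    (fun T φ => (ev (tensor M N) T ((dual (tensor M N)).map φ s)).comp
      ((TensorProduct.mk T (M.obj T) (N.obj T)).flip (N.map φ y)))
    (fun T U φ ψ x => by
      have h := ev_map (tensor M N) ψ ((dual (tensor M N)).map φ s) (x ⊗ₜ[T] N.map φ y)
      have h' : (tensor M N).map ψ (x ⊗ₜ[T] N.map φ y) =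
        M.map ψ x ⊗ₜ[U] N.map (ψ.comp φ) y := by
          rw [N.map_comp]; rfl
      rw [h'] at h
      exact h)
  map_add' y y' := dual_ext fun T φ x =>
    (congrArg (ev (tensor M N) T ((dual (tensor M N)).map φ s)) <| by
      rw [map_add]; exact TensorProduct.tmul_add _ _ _).trans (map_add _ _ _)
  map_smul' r y := dual_ext fun T φ x =>
    (congrArg (ev (tensor M N) T ((dual (tensor M N)).map φ s))
      ((congrArg (fun z => x ⊗ₜ[T] z) ((N.map φ).map_smulₛₗ r y)).trans
        (TensorProduct.tmul_smul (φ r) x (N.map φ y)))).trans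
          (map_smul (ev (tensor M N) T ((dual (tensor M N)).map φ s)) (φ r) (x ⊗ₜ[T] N.map φ y))

@[simp]
lemma ev_evalRight {M : ModFun.{u, v} R} {N : ModFun.{u, w} R} {S : CommAlgCat.{u} R}
    (s : (dual (tensor M N)).obj S) (x : M.obj S) (y : N.obj S) :
    ev M S (evalRight s y) x = ev (tensor M N) S s (x ⊗ₜ[S] y) :=
  congrArg (fun y => ev (tensor M N) S s (x ⊗ₜ[S] y)) (N.map_id S y)

lemma map_evalLeft {M : ModFun.{u, v} R} {N : ModFun.{u, w} R} {S T : CommAlgCat.{u} R}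
    (φ : S →ₐ[R] T) (s : (dual (tensor M N)).obj S) (x : M.obj S) :
    (dual N).map φ (evalLeft s x) = evalLeft ((dual (tensor M N)).map φ s) (M.map φ x) :=
  dual_ext fun U ψ y => congrArg (fun x => ev (tensor M N) U
    ((dual (tensor M N)).map (ψ.comp φ) s) (x ⊗ₜ[U] y)) (M.map_comp φ ψ x)

lemma map_evalRight {M : ModFun.{u, v} R} {N : ModFun.{u, w} R} {S T : CommAlgCat.{u} R}
    (φ : S →ₐ[R] T) (s : (dual (tensor M N)).obj S) (y : N.obj S) :
    (dual M).map φ (evalRight s y) = evalRight ((dual (tensor M N)).map φ s) (N.map φ y) :=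
  dual_ext fun U ψ x => congrArg (fun y => ev (tensor M N) U
    ((dual (tensor M N)).map (ψ.comp φ) s) (x ⊗ₜ[U] y)) (N.map_comp φ ψ y)

/-! ### Inverses and transport of structure -/

/-- The inverse of an isomorphism. -/
def Hom.inv {M : ModFun.{u, v} R} {N : ModFun.{u, w} R} (f : Hom M N) (hf : f.IsIso) :
    Hom N M where
  app S := (LinearEquiv.ofBijective (f.app S) (hf S)).symm.toLinearMap
  naturality {S T} φ y := (hf T).1 <| by
    obtain ⟨x, rfl⟩ := (hf S).2 y
    rw [← f.naturality]
    simp [f.naturality]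

@[simp]
lemma Hom.inv_app_app {M : ModFun.{u, v} R} {N : ModFun.{u, w} R} (f : Hom M N) (hf : f.IsIso)
    {S : CommAlgCat.{u} R} (x : M.obj S) : (f.inv hf).app S (f.app S x) = x :=
  (LinearEquiv.ofBijective (f.app S) (hf S)).symm_apply_apply x

@[simp]
lemma Hom.app_inv_app {M : ModFun.{u, v} R} {N : ModFun.{u, w} R} (f : Hom M N) (hf : f.IsIso)
    {S : CommAlgCat.{u} R} (x : N.obj S) : f.app S ((f.inv hf).app S x) = x :=
  (LinearEquiv.ofBijective (f.app S) (hf S)).apply_symm_apply x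

lemma Hom.IsIso.of_inverse {M : ModFun.{u, v} R} {N : ModFun.{u, w} R} {f : Hom M N}
    (g : Hom N M) (h₁ : ∀ S x, g.app S (f.app S x) = x) (h₂ : ∀ S x, f.app S (g.app S x) = x) :
    f.IsIso :=
  fun S => ⟨Function.LeftInverse.injective (h₁ S), Function.RightInverse.surjective (h₂ S)⟩

/-- Transport of an algebra structure along an isomorphism. -/
def AlgStr.transport {M : ModFun.{u, v} R} {N : ModFun.{u, w} R} (a : AlgStr M) (f : Hom M N)
    (hf : f.IsIso) : AlgStr N where
  mul S := ((a.mul S).compl₁₂ ((f.inv hf).app S) ((f.inv hf).app S)).compr₂ (f.app S)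
  one S := f.app S (a.one S)
  mul_assoc S x y z := by simp [a.mul_assoc]
  one_mul S x := by simp [a.one_mul]
  mul_one S x := by simp [a.mul_one]
  map_mul φ x y := by simp [← Hom.naturality, a.map_mul]
  map_one φ := by rw [← f.naturality, a.map_one]

lemma AlgStr.transport_mul {M : ModFun.{u, v} R} {N : ModFun.{u, w} R} (a : AlgStr M)
    (f : Hom M N) (hf : f.IsIso) (S : CommAlgCat.{u} R) (x y : M.obj S) :
    (a.transport f hf).mul S (f.app S x) (f.app S y) = f.app S (a.mul S x y) := by
  simp [transport]

lemma AlgStr.isAlgHom_transport {M : ModFun.{u, v} R} {N : ModFun.{u, w} R} (a : AlgStr M)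
    (f : Hom M N) (hf : f.IsIso) : IsAlgHom a (a.transport f hf) f :=
  ⟨fun S x y => (a.transport_mul f hf S x y).symm, fun _ => rfl⟩

lemma IsAlgHom.inv {M : ModFun.{u, v} R} {N : ModFun.{u, w} R} {a : AlgStr M} {b : AlgStr N}
    {f : Hom M N} (h : IsAlgHom a b f) (hf : f.IsIso) : IsAlgHom b a (f.inv hf) where
  map_mul S x y := (hf S).1 (by simp [h.map_mul])
  map_one S := (hf S).1 (by simp [h.map_one])

/-- The quotient induced along a surjective morphism of algebras. -/
def QCohAlgQuot.comap {M : ModFun.{u, v} R} {N : ModFun.{u, w} R} {a : AlgStr M} {b : AlgStr N}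
    {f : Hom M N} (h : IsAlgHom a b f) (hf : ∀ S, Function.Surjective (f.app S))
    (Q : QCohAlgQuot b) : QCohAlgQuot a where
  A := Q.A
  proj := Q.proj.comp f
  isAlgHom := Q.isAlgHom.comp h
  surjective S := (Q.surjective S).comp (hf S)

lemma qcohMap_id (A : Type u) [AddCommGroup A] [Module R A] (S : CommAlgCat.{u} R)
    (x : (qcoh R A).obj S) : (qcohMap (LinearMap.id : A →ₗ[R] A)).app S x = x :=
  LinearMap.congr_fun (LinearMap.baseChange_id (R := R) (A := S) (M := A)) x

/-- Quasi-coherent quotients can be pulled back along the isomorphism in both directions, so the two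
limits run over the same data. -/
lemma IsProquasiCoherent.of_isIso {M : ModFun.{u, v} R} {N : ModFun.{u, w} R} {a : AlgStr M}
    {b : AlgStr N} (ha : IsProquasiCoherent a) {f : Hom M N} (h : IsAlgHom a b f)
    (hf : f.IsIso) : IsProquasiCoherent b := by
  have hinv : ∀ S, Function.Surjective ((f.inv hf).app S) := fun S x => ⟨f.app S x, by simp⟩
  intro S x hx
  obtain ⟨m, hm, huniq⟩ := ha S (fun Q => x (Q.comap (h.inv hf) hinv)) fun Q Q' g hg =>
    hx (Q.comap (h.inv hf) hinv) (Q'.comap (h.inv hf) hinv) g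
      (Hom.ext_app fun S y => Hom.congr_app hg S ((f.inv hf).app S y))
  refine ⟨f.app S m, fun Q => ?_, fun n hn => ?_⟩
  -- Pulling `Q` back along `f` and then along its inverse gives an index with the same algebra, but
  -- not literally `Q`. The identity of `Q.A` is a morphism between the two, so compatibility of the
  -- family equates their entries.
  · rw [← hx ((Q.comap h fun S => (hf S).2).comap (h.inv hf) hinv) Q
      (AlgHom.id R Q.A) (Hom.ext_app fun S y => ?_), ← hm (Q.comap h fun S => (hf S).2)]
    · exact (qcohMap_id Q.A S _).symm
    · exact (qcohMap_id Q.A S _).trans (congrArg (Q.proj.app S) (f.app_inv_app hf y))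
  · rw [← huniq ((f.inv hf).app S n) fun Q => hn (Q.comap (h.inv hf) hinv), f.app_inv_app]

/-! ### Duality for quasi-coherent modules -/

/-- Stated for additive maps because the transition maps to which it is applied are only semilinear.
-/
lemma addHom_tensor_ext {B : Type u} [AddCommGroup B] [Module R B]
    {S : CommAlgCat.{u} R} {M N : Type*} [AddCommGroup M] [Module S M]
    [AddCommGroup N] {F G : M ⊗[S] (S ⊗[R] B) →+ N}
    (h : ∀ (m : M) (s : S) (b : B), F (m ⊗ₜ[S] (s ⊗ₜ[R] b)) = G (m ⊗ₜ[S] (s ⊗ₜ[R] b)))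
    (x : M ⊗[S] (S ⊗[R] B)) : F x = G x := by
  induction x with
  | zero => simp
  | add x y hx hy => rw [map_add, map_add, hx, hy]
  | tmul m y =>
    induction y with
    | zero => simp
    | add x y hx hy => rw [TensorProduct.tmul_add, map_add, map_add, hx, hy]
    | tmul s b => exact h m s b

section QuasiCoherent

variable (A B : Type u) [AddCommGroup A] [Module R A] [AddCommGroup B] [Module R B]

/-- The functional on `𝓐` over `S` associated with a linear map `A → S`. -/
def ofLin {S : CommAlgCat.{u} R} (l : A →ₗ[R] S) : (dual (qcoh R A)).obj S :=
  ofEv (qcoh R A) (fun T φ => LinearMap.liftBaseChange T (φ.toLinearMap.comp l))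
    fun T U φ ψ x => by
      suffices H : ∀ x : T ⊗[R] A, LinearMap.liftBaseChange U ((ψ.comp φ).toLinearMap.comp l)
          (TensorProduct.map ψ.toLinearMap LinearMap.id x) =
            ψ (LinearMap.liftBaseChange T (φ.toLinearMap.comp l) x) from H x
      intro x
      induction x with
      | zero => simp
      | tmul t a => simp
      | add x y hx hy => simp only [map_add, hx, hy]

variable {A} in
lemma ev_map_ofLin_tmul {S T : CommAlgCat.{u} R} (φ : S →ₐ[R] T) (l : A →ₗ[R] S) (t : T) (a : A) :
    ev (qcoh R A) T ((dual (qcoh R A)).map φ (ofLin A l)) (t ⊗ₜ[R] a) = t * φ (l a) :=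
  LinearMap.liftBaseChange_tmul T (φ.toLinearMap.comp l) t a

variable {A} in
lemma qcoh_dual_ext {S : CommAlgCat.{u} R} {f g : (dual (qcoh R A)).obj S}
    (h : ∀ (T : CommAlgCat.{u} R) (φ : S →ₐ[R] T) (a : A),
      ev (qcoh R A) T ((dual (qcoh R A)).map φ f) ((1 : T) ⊗ₜ[R] a) =
        ev (qcoh R A) T ((dual (qcoh R A)).map φ g) ((1 : T) ⊗ₜ[R] a)) : f = g :=
  dual_ext fun T φ x => LinearMap.congr_fun
    (show (ev (qcoh R A) T ((dual (qcoh R A)).map φ f) : T ⊗[R] A →ₗ[T] T) =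
      ev (qcoh R A) T ((dual (qcoh R A)).map φ g) from
      TensorProduct.AlgebraTensorModule.curry_injective <| LinearMap.ext fun t =>
        LinearMap.ext fun a => by
          have h' := congrArg (fun r => t • r) (h T φ a)
          have ht : t ⊗ₜ[R] a = t • ((1 : T) ⊗ₜ[R] a) := by
            rw [TensorProduct.smul_tmul', smul_eq_mul, mul_one]
          change ev (qcoh R A) T ((dual (qcoh R A)).map φ f) (t ⊗ₜ[R] a) =
            ev (qcoh R A) T ((dual (qcoh R A)).map φ g) (t ⊗ₜ[R] a)
          rw [ht]
          exact (map_smul (ev (qcoh R A) T ((dual (qcoh R A)).map φ f)) t _).trans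
            (h'.trans (map_smul (ev (qcoh R A) T ((dual (qcoh R A)).map φ g)) t _).symm)) x

/-! ### The generic functional and its specializations to dual numbers. -/

/-- The ring `S ⊕ (S ⊗ A)`. -/
def genRing (S : CommAlgCat.{u} R) : CommAlgCat.{u} R :=
  CommAlgCat.of R (TrivSqZeroExt S (S ⊗[R] A))

/-- The inclusion of `S` in `S ⊕ (S ⊗ A)`. -/
def genIncl (S : CommAlgCat.{u} R) : S →ₐ[R] genRing A S :=
  TrivSqZeroExt.inlAlgHom R S (S ⊗[R] A)

/-- The inclusion of `S ⊗ A` in `S ⊕ (S ⊗ A)`. -/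
def genInr (S : CommAlgCat.{u} R) : S ⊗[R] A →ₗ[R] genRing A S :=
  (TrivSqZeroExt.inrHom S (S ⊗[R] A)).restrictScalars R

lemma genIncl_mul_inr (S : CommAlgCat.{u} R) (s : S) (x : S ⊗[R] A) :
    genIncl A S s * genInr A S x = genInr A S (s • x) :=
  TrivSqZeroExt.inl_mul_inr s x

/-- The projection of `S ⊕ (S ⊗ A)` onto `S ⊗ A`. -/
def genSnd (S : CommAlgCat.{u} R) : genRing A S →ₗ[R] S ⊗[R] A :=
  (TrivSqZeroExt.sndHom S (S ⊗[R] A)).restrictScalars R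

/-- The generic functional on `𝓐`, defined over `S ⊕ (S ⊗ A)`. -/
def genFun (S : CommAlgCat.{u} R) : (dual (qcoh R A)).obj (genRing A S) :=
  ofLin A (S := genRing A S)
    ((genInr A S).comp (TensorProduct.mk R S A 1))

/-- The dual numbers over `T`. -/
def dualNum (T : CommAlgCat.{u} R) : CommAlgCat.{u} R :=
  CommAlgCat.of R (TrivSqZeroExt T T)

/-- The inclusion of `T` in the dual numbers. -/
def dualNumIncl (T : CommAlgCat.{u} R) : T →ₐ[R] dualNum T :=
  TrivSqZeroExt.inlAlgHom R T T

/-- The projection `s + t ε ↦ t`. -/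
def dualNumSnd (T : CommAlgCat.{u} R) : dualNum T →ₗ[R] T :=
  (TrivSqZeroExt.sndHom T T).restrictScalars R

/-- The inclusion `t ↦ t ε`. -/
def dualNumInr (T : CommAlgCat.{u} R) : T →ₗ[R] dualNum T :=
  (TrivSqZeroExt.inrHom T T).restrictScalars R

lemma dualNumIncl_mul_inr (T : CommAlgCat.{u} R) (s t : T) :
    dualNumIncl T s * dualNumInr T t = dualNumInr T (s * t) :=
  TrivSqZeroExt.inl_mul_inr s t

lemma dualNumInr_mul_inr (T : CommAlgCat.{u} R) (s t : T) :
    dualNumInr T s * dualNumInr T t = 0 :=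
  TrivSqZeroExt.inr_mul_inr T s t

lemma dualNumSnd_inr (T : CommAlgCat.{u} R) (t : T) : dualNumSnd T (dualNumInr T t) = t :=
  TrivSqZeroExt.snd_inr T t

lemma dualNumSnd_incl (T : CommAlgCat.{u} R) (t : T) : dualNumSnd T (dualNumIncl T t) = 0 :=
  TrivSqZeroExt.snd_inl T t

variable {A} in
/-- The linear map `S ⊗ A → T` given by a functional over `T` and a morphism `S → T`. -/
def evalAt {S T : CommAlgCat.{u} R} (φ : S →ₐ[R] T) (f : (dual (qcoh R A)).obj T) :
    S ⊗[R] A →ₗ[R] T :=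
  ((id (ev (qcoh R A) T f) : T ⊗[R] A →ₗ[T] T).restrictScalars R).comp
    (TensorProduct.map φ.toLinearMap LinearMap.id)

variable {A} in
lemma evalAt_smul {S T : CommAlgCat.{u} R} (φ : S →ₐ[R] T) (f : (dual (qcoh R A)).obj T)
    (s : S) (x : S ⊗[R] A) : evalAt φ f (s • x) = φ s * evalAt φ f x :=
  (congrArg (ev (qcoh R A) T f) (((qcoh R A).map φ).map_smulₛₗ s x)).trans
    (map_smul (ev (qcoh R A) T f) (φ s) ((qcoh R A).map φ x))

variable {A} in
/-- The morphism `S ⊕ (S ⊗ A) → T[ε]`, `s + x ↦ s + f(x) ε`. -/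
def specialize {S T : CommAlgCat.{u} R} (φ : S →ₐ[R] T) (f : (dual (qcoh R A)).obj T) :
    genRing A S →ₐ[R] dualNum T :=
  TrivSqZeroExt.lift ((dualNumIncl T).comp φ)
    ((dualNumInr T).comp (evalAt φ f))
    (fun x y => dualNumInr_mul_inr T _ _)
    (fun s x => by
      change dualNumInr T (evalAt φ f (s • x)) = dualNumIncl T (φ s) * dualNumInr T (evalAt φ f x)
      rw [evalAt_smul, dualNumIncl_mul_inr])
    (fun s x => by
      change dualNumInr T (evalAt φ f (MulOpposite.op s • x)) =
        dualNumInr T (evalAt φ f x) * dualNumIncl T (φ s)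
      rw [op_smul_eq_smul, evalAt_smul, mul_comm (dualNumInr T _), dualNumIncl_mul_inr])

variable {A} in
lemma specialize_inr {S T : CommAlgCat.{u} R} (φ : S →ₐ[R] T) (f : (dual (qcoh R A)).obj T)
    (x : S ⊗[R] A) : specialize φ f (genInr A S x) = dualNumInr T (evalAt φ f x) := by
  unfold specialize
  exact TrivSqZeroExt.lift_apply_inr _ _ _ _ _ x

variable {A} in
lemma specialize_incl {S T : CommAlgCat.{u} R} (φ : S →ₐ[R] T) (f : (dual (qcoh R A)).obj T)
    (s : S) : specialize φ f (genIncl A S s) = dualNumIncl T (φ s) := by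
  unfold specialize
  exact TrivSqZeroExt.lift_apply_inl _ _ _ _ _ s

variable {A} in
lemma specialize_comp_genIncl {S T : CommAlgCat.{u} R} (φ : S →ₐ[R] T)
    (f : (dual (qcoh R A)).obj T) :
    (specialize φ f).comp (genIncl A S) = (dualNumIncl T).comp φ :=
  AlgHom.ext (specialize_incl φ f)

variable {A} in
lemma dualNumSnd_specialize {S T : CommAlgCat.{u} R} (φ : S →ₐ[R] T)
    (f : (dual (qcoh R A)).obj T) :
    (dualNumSnd T).comp (specialize φ f).toLinearMap = (evalAt φ f).comp (genSnd A S) := by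
  refine LinearMap.ext fun x => ?_
  have hx : x = genIncl A S (TrivSqZeroExt.fst x) + genInr A S (genSnd A S x) :=
    (TrivSqZeroExt.inl_fst_add_inr_snd_eq x).symm
  change dualNumSnd T (specialize φ f x) = evalAt φ f (genSnd A S x)
  rw [congrArg (specialize φ f) hx, map_add, map_add, specialize_incl, specialize_inr,
    dualNumSnd_incl, dualNumSnd_inr, zero_add]

variable {A} in
-- The universal property of the generic functional: both sides send 1 ⊗ a to ε f(1 ⊗ a). The factor
-- ε is the price of using a square-zero extension, which keeps the generic ring linear in A.
lemma map_specialize_genFun {S T : CommAlgCat.{u} R} (φ : S →ₐ[R] T)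
    (f : (dual (qcoh R A)).obj T) :
    (dual (qcoh R A)).map (specialize φ f) (genFun A S) =
      dualNumInr T 1 • (dual (qcoh R A)).map (dualNumIncl T) f := by
  refine qcoh_dual_ext fun U ψ a => ?_
  have h1 : ev (qcoh R A) U ((dual (qcoh R A)).map ψ ((dual (qcoh R A)).map (specialize φ f)
      (genFun A S))) ((1 : U) ⊗ₜ[R] a) = ψ (specialize φ f (genInr A S (1 ⊗ₜ[R] a))) :=
    (ev_map_ofLin_tmul (ψ.comp (specialize φ f)) _ (1 : U) a).trans (one_mul _)
  have h2 : ev (qcoh R A) U ((dual (qcoh R A)).map (ψ.comp (dualNumIncl T)) f)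
      ((qcoh R A).map (ψ.comp (dualNumIncl T)) ((1 : T) ⊗ₜ[R] a)) =
        ψ (dualNumIncl T (evalAt φ f (1 ⊗ₜ[R] a))) :=
    (ev_map (qcoh R A) (ψ.comp (dualNumIncl T)) f ((1 : T) ⊗ₜ[R] a)).trans
      (congrArg (fun t : T => ψ (dualNumIncl T (ev (qcoh R A) T f (t ⊗ₜ[R] a)))) (map_one φ).symm)
  have h3 : (qcoh R A).map (ψ.comp (dualNumIncl T)) ((1 : T) ⊗ₜ[R] a) = (1 : U) ⊗ₜ[R] a :=
    congrArg (fun u : U => u ⊗ₜ[R] a) (map_one (ψ.comp (dualNumIncl T)))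
  rw [h3] at h2
  refine h1.trans (Eq.trans ?_ (congrArg (fun y => ψ (dualNumInr T 1) * y) h2.symm))
  rw [specialize_inr, ← map_mul, mul_comm, dualNumIncl_mul_inr, mul_one]

variable {B} in
-- Division by ε: a value in T ⊗ B is recovered from its ε-multiple over T[ε].
lemma dualNumSnd_smul_map (T : CommAlgCat.{u} R) (y : T ⊗[R] B) :
    TensorProduct.map (dualNumSnd T) (LinearMap.id : B →ₗ[R] B)
      (dualNumInr T 1 • TensorProduct.map (dualNumIncl T).toLinearMap LinearMap.id y) = y := by
  induction y with
  | zero => simp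
  | add x y hx hy => simp only [map_add, smul_add, hx, hy]
  | tmul t b =>
    rw [TensorProduct.map_tmul, TensorProduct.smul_tmul', TensorProduct.map_tmul, smul_eq_mul,
      mul_comm]
    exact congrArg (fun t : T => t ⊗ₜ[R] b) (by
      rw [AlgHom.toLinearMap_apply, dualNumIncl_mul_inr, dualNumSnd_inr, mul_one])

variable {A B} in
/-- Every morphism `𝓐* → 𝓑` over `S` is given by an element of `(S ⊗ A) ⊗ B`. -/
lemma exists_tensor_of_hom {S : CommAlgCat.{u} R}
    (f : (ihom (dual (qcoh R A)) (qcoh R B)).obj S) :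
    ∃ μ : (S ⊗[R] A) ⊗[R] B, ∀ (T : CommAlgCat.{u} R) (φ : S →ₐ[R] T)
      (g : (dual (qcoh R A)).obj T),
        f.1 T φ g = TensorProduct.map (evalAt φ g) (LinearMap.id : B →ₗ[R] B) μ := by
  -- The witness is the (S ⊗ A)-component of the value at the generic functional.
  refine ⟨TensorProduct.map (genSnd A S) LinearMap.id (f.1 _ (genIncl A S) (genFun A S)),
    fun T φ g => ?_⟩
  -- Naturality along `specialize φ g` and along T → T[ε], with linearity, shows that ε times the
  -- value at `g` is the specialization of the value at the generic functional. Taking ε-parts gives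
  -- the claim.
  have h1 := f.2 _ _ (genIncl A S) (specialize φ g) (genFun A S)
  rw [specialize_comp_genIncl, map_specialize_genFun] at h1
  have h2 := f.2 _ _ φ (dualNumIncl T) g
  have h3 := (map_smul (f.1 _ ((dualNumIncl T).comp φ)) (dualNumInr T 1)
    ((dual (qcoh R A)).map (dualNumIncl T) g)).symm.trans h1
  rw [h2] at h3
  have h4 : ∀ z : genRing A S ⊗[R] B, TensorProduct.map (dualNumSnd T) LinearMap.id
      (TensorProduct.map (specialize φ g).toLinearMap (LinearMap.id : B →ₗ[R] B) z) =
      TensorProduct.map (evalAt φ g) (LinearMap.id : B →ₗ[R] B)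
        (TensorProduct.map (genSnd A S) LinearMap.id z) := fun z => by
    rw [← LinearMap.comp_apply, ← LinearMap.comp_apply, ← TensorProduct.map_comp,
      ← TensorProduct.map_comp, dualNumSnd_specialize]
  exact (dualNumSnd_smul_map T _).symm.trans
    ((congrArg (TensorProduct.map (dualNumSnd T) (LinearMap.id : B →ₗ[R] B)) h3).trans (h4 _))

/-- The generic functional evaluates as the tautological inclusion of S ⊗ A, so this single
functional already separates points. -/
lemma evalAt_genFun (S : CommAlgCat.{u} R) : evalAt (genIncl A S) (genFun A S) = genInr A S := by
  refine TensorProduct.ext' fun s a => ?_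
  refine (ev_map_ofLin_tmul (AlgHom.id R (genRing A S))
    ((genInr A S).comp (TensorProduct.mk R S A 1)) (genIncl A S s) a).trans ?_
  refine (genIncl_mul_inr A S s (1 ⊗ₜ[R] a)).trans ?_
  rw [TensorProduct.smul_tmul', smul_eq_mul, mul_one]

variable {A} in
lemma genInr_injective (S : CommAlgCat.{u} R) : Function.Injective (genInr A S) :=
  TrivSqZeroExt.inr_injective

variable {A} in
/-- Functionals on `𝓐` over all `S`-algebras separate the points of `S ⊗ A`. -/
lemma eq_zero_of_evalAt {S : CommAlgCat.{u} R} (x : S ⊗[R] A)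
    (h : ∀ (T : CommAlgCat.{u} R) (φ : S →ₐ[R] T) (f : (dual (qcoh R A)).obj T),
      evalAt φ f x = 0) : x = 0 :=
  genInr_injective S (by rw [← evalAt_genFun, h, map_zero])

variable {A B} in
/-- Functionals on `𝓐` and `𝓑` over all `S`-algebras separate the points of `(S ⊗ A) ⊗ B`. -/
lemma eq_zero_of_map_evalAt {S : CommAlgCat.{u} R} (x : (S ⊗[R] A) ⊗[R] B)
    (h : ∀ (T : CommAlgCat.{u} R) (φ : S →ₐ[R] T) (f : (dual (qcoh R A)).obj T),
      TensorProduct.map (evalAt φ f) (LinearMap.id : B →ₗ[R] B) x = 0) : x = 0 := by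
  have h1 := h _ (genIncl A S) (genFun A S)
  rw [evalAt_genFun] at h1
  have h2 : (genSnd A S).comp (genInr A S) = LinearMap.id :=
    LinearMap.ext fun y => TrivSqZeroExt.snd_inr S y
  have h3 := congrArg (TensorProduct.map (genSnd A S) (LinearMap.id : B →ₗ[R] B)) h1
  rwa [← LinearMap.comp_apply, ← TensorProduct.map_comp, h2, LinearMap.comp_id,
    TensorProduct.map_id, LinearMap.id_apply, map_zero] at h3

/-- Injectivity is separation of points. Surjectivity is the description of morphisms 𝓐* → 𝓑 by
tensors, in the case B = R. -/
lemma bidual_qcoh_isIso : (bidual (qcoh R A)).IsIso := by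
  intro S
  constructor
  · refine (injective_iff_map_eq_zero _).2 fun x hx => eq_zero_of_evalAt x fun T φ f => ?_
    have h : ev (dual (qcoh R A)) T ((dual (dual (qcoh R A))).map φ
        ((bidual (qcoh R A)).app S x)) f = 0 := by
      rw [hx, map_zero]; rfl
    rw [← Hom.naturality, ev_bidual] at h
    exact h
  · intro F
    let f : (ihom (dual (qcoh R A)) (qcoh R R)).obj S :=
      ⟨fun T φ => (TensorProduct.AlgebraTensorModule.rid R T T).symm.toLinearMap.comp
        (ev (dual (qcoh R A)) T ((dual (dual (qcoh R A))).map φ F)), fun T U φ ψ g => by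
          have h := ev_map (dual (qcoh R A)) ψ ((dual (dual (qcoh R A))).map φ F) g
          change (TensorProduct.AlgebraTensorModule.rid R U U).symm
            (ev (dual (qcoh R A)) U ((dual (dual (qcoh R A))).map (ψ.comp φ) F)
              ((dual (qcoh R A)).map ψ g)) = _
          exact congrArg (fun u : U => u ⊗ₜ[R] (1 : R)) h⟩
    obtain ⟨μ, hμ⟩ := exists_tensor_of_hom f
    refine ⟨TensorProduct.rid R (S ⊗[R] A) μ, dual_ext fun T φ g => ?_⟩
    refine ((congrArg (fun G => ev (dual (qcoh R A)) T G g)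
      ((bidual (qcoh R A)).naturality φ (TensorProduct.rid R (S ⊗[R] A) μ))).symm.trans
        (ev_bidual _ g)).trans ?_
    have h := congrArg (TensorProduct.rid R T) (hμ T φ g)
    have h1 : ∀ t : T, TensorProduct.rid R T
      ((TensorProduct.AlgebraTensorModule.rid R T T).symm t) = t := fun t => by simp
    refine Eq.trans ?_ (h.symm.trans (h1 _))
    exact LinearMap.congr_fun (TensorProduct.ext' (fun x r => by simp) :
      (evalAt φ g).comp (TensorProduct.rid R (S ⊗[R] A)).toLinearMap =
        (TensorProduct.rid R T).toLinearMap.comp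
          (TensorProduct.map (evalAt φ g) (LinearMap.id : R →ₗ[R] R))) μ

variable {A} in
lemma comp_evalAt {S T U : CommAlgCat.{u} R} (φ : S →ₐ[R] T) (ψ : T →ₐ[R] U)
    (f : (dual (qcoh R A)).obj T) :
    ψ.toLinearMap.comp (evalAt φ f) = evalAt (ψ.comp φ) ((dual (qcoh R A)).map ψ f) := by
  refine LinearMap.ext fun x => (ev_map (qcoh R A) ψ f ((qcoh R A).map φ x)).symm.trans ?_
  exact congrArg (ev (qcoh R A) U ((dual (qcoh R A)).map ψ f)) ((qcoh R A).map_comp φ ψ x).symm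

variable {A B} in
-- After (S ⊗ A) ⊗_S (S ⊗ B) is identified with (S ⊗ A) ⊗_R B, pairing with f ⊗ g is contraction by
-- `f`, then by `g`. This lets the two factors be treated one at a time.
lemma evTensor_map_tensor {S T : CommAlgCat.{u} R} (φ : S →ₐ[R] T) (f : (dual (qcoh R A)).obj T)
    (g : (dual (qcoh R B)).obj T) (x : (S ⊗[R] A) ⊗[S] (S ⊗[R] B)) :
    evTensor (qcoh R A) (qcoh R B) T (f ⊗ₜ[T] g) ((tensor (qcoh R A) (qcoh R B)).map φ x) =
      ev (qcoh R B) T g (TensorProduct.map (evalAt φ f) (LinearMap.id : B →ₗ[R] B)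
        (AlgebraTensorModule.cancelBaseChange R S S (S ⊗[R] A) B x)) := by
  let F : (S ⊗[R] A) ⊗[S] (S ⊗[R] B) →+ T :=
    (evTensor (qcoh R A) (qcoh R B) T (f ⊗ₜ[T] g)).toAddMonoidHom.comp
      ((tensor (qcoh R A) (qcoh R B)).map φ).toAddMonoidHom
  let G : (S ⊗[R] A) ⊗[S] (S ⊗[R] B) →+ T :=
    (ev (qcoh R B) T g).toAddMonoidHom.comp
      ((TensorProduct.map (evalAt φ f) (LinearMap.id : B →ₗ[R] B)).toAddMonoidHom.comp
        (AlgebraTensorModule.cancelBaseChange R S S (S ⊗[R] A) B).toLinearMap.toAddMonoidHom)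
  refine addHom_tensor_ext (F := F) (G := G) (fun x s b => ?_) x
  change evalAt φ f x * ev (qcoh R B) T g (φ s ⊗ₜ[R] b) = ev (qcoh R B) T g
    (evalAt φ f (s • x) ⊗ₜ[R] b)
  rw [evalAt_smul]
  refine (map_smul (ev (qcoh R B) T g) (evalAt φ f x) (φ s ⊗ₜ[R] b)).symm.trans ?_
  refine congrArg (ev (qcoh R B) T g) ?_
  refine (TensorProduct.smul_tmul' (evalAt φ f x) (φ s) b).trans ?_
  rw [smul_eq_mul, mul_comm]

/-- A bilinear form on 𝓐* × 𝓑* is a morphism 𝓐* → 𝓑** = 𝓑, hence comes from a tensor. Injectivity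
separates points in A and then in B. -/
lemma toCtensor_qcoh_isIso : (toCtensor (qcoh R A) (qcoh R B)).IsIso := by
  intro S
  constructor
  · refine (injective_iff_map_eq_zero _).2 fun x hx => ?_
    refine (AlgebraTensorModule.cancelBaseChange R S S (S ⊗[R] A) B).map_eq_zero_iff.1 ?_
    refine eq_zero_of_map_evalAt _ fun T φ f => eq_zero_of_evalAt _ fun U ψ g => ?_
    have h : ev (tensor (dual (qcoh R A)) (dual (qcoh R B))) U
        ((ctensor (qcoh R A) (qcoh R B)).map (ψ.comp φ)
          ((toCtensor (qcoh R A) (qcoh R B)).app S x))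
            ((dual (qcoh R A)).map ψ f ⊗ₜ[U] g) = 0 := by
      rw [hx, map_zero]; rfl
    rw [← Hom.naturality] at h
    refine Eq.trans ?_ ((evTensor_map_tensor (ψ.comp φ) _ g x).symm.trans
      ((ev_toCtensor_eq _ _).symm.trans h))
    rw [← comp_evalAt]
    have h2 : ∀ μ : (S ⊗[R] A) ⊗[R] B, TensorProduct.map ψ.toLinearMap (LinearMap.id : B →ₗ[R] B)
        (TensorProduct.map (evalAt φ f) LinearMap.id μ) =
          TensorProduct.map (ψ.toLinearMap.comp (evalAt φ f)) LinearMap.id μ := fun μ => by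
      rw [← LinearMap.comp_apply, ← TensorProduct.map_comp, LinearMap.id_comp]
    exact congrArg (ev (qcoh R B) U g) (h2 _)
  · intro β
    -- The form `β` curried in its first variable, with 𝓑** replaced by 𝓑.
    let f : (ihom (dual (qcoh R A)) (qcoh R B)).obj S :=
      ⟨fun T φ => ((((bidual (qcoh R B)).inv (bidual_qcoh_isIso B)).app T)).comp
        (evalLeft ((ctensor (qcoh R A) (qcoh R B)).map φ β)), fun T U φ ψ g => by
          rw [LinearMap.comp_apply, LinearMap.comp_apply, ← Hom.naturality]
          exact congrArg _ (map_evalLeft ψ ((ctensor (qcoh R A) (qcoh R B)).map φ β) g).symm⟩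
    obtain ⟨μ, hμ⟩ := exists_tensor_of_hom f
    refine ⟨(AlgebraTensorModule.cancelBaseChange R S S (S ⊗[R] A) B).symm μ,
      tensor_dual_ext fun T φ g k => ?_⟩
    refine (congrArg (fun s => ev (tensor (dual (qcoh R A)) (dual (qcoh R B))) T s (g ⊗ₜ[T] k))
      ((toCtensor (qcoh R A) (qcoh R B)).naturality φ _).symm).trans ?_
    refine (ev_toCtensor_eq _ _).trans ((evTensor_map_tensor φ g k _).trans ?_)
    rw [LinearEquiv.apply_symm_apply]
    refine (congrArg (ev (qcoh R B) T k) (hμ T φ g).symm).trans ?_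
    rw [← ev_evalLeft, ← ev_bidual]
    exact congrArg (fun F => ev (dual (qcoh R B)) T F k)
      ((bidual (qcoh R B)).app_inv_app (bidual_qcoh_isIso B) _)

end QuasiCoherent

/-! ### Frames -/

section Frames

open scoped Classical

/-! ### Functionals on a product of copies of 𝓡. -/

/-- The functional on `∏_J 𝓡`-coordinates of the dual of `⊕_J 𝓡`. -/
def dualFinsuppCoord (J : Type u) : Hom (dual (qcoh R (J →₀ R))) (prodUnit R J) where
  app S :=
    { toFun := fun f j => ev (qcoh R (J →₀ R)) S f ((1 : S) ⊗ₜ[R] Finsupp.single j (1 : R))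
      map_add' := fun _ _ => rfl
      map_smul' := fun _ _ => rfl }
  naturality {S T} φ f := funext fun j =>
    (congrArg (fun t : T => ev (qcoh R (J →₀ R)) T ((dual (qcoh R (J →₀ R))).map φ f)
      (t ⊗ₜ[R] Finsupp.single j (1 : R))) (map_one φ).symm).trans
      (ev_map (qcoh R (J →₀ R)) φ f ((1 : S) ⊗ₜ[R] Finsupp.single j (1 : R)))

lemma exists_finsupp_ev_ofLin (J : Type u) (S : CommAlgCat.{u} R) (z : S ⊗[R] (J →₀ R)) :
    ∃ μ : J →₀ S, ∀ c : J → S,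
      ev (qcoh R (J →₀ R)) S (ofLin (J →₀ R) (Finsupp.linearCombination R c)) z =
        ∑ᶠ j, c j * μ j := by
  have hfin : ∀ (c : J → S) (μ : J →₀ S), (Function.support fun j => c j * μ j).Finite :=
    fun c μ => μ.support.finite_toSet.subset fun j hj =>
      Finsupp.mem_support_iff.2 (right_ne_zero_of_mul hj)
  have hadd : ∀ z z' : S ⊗[R] (J →₀ R), (∃ μ : J →₀ S, ∀ c : J → S,
      ev (qcoh R (J →₀ R)) S (ofLin (J →₀ R) (Finsupp.linearCombination R c)) z =
        ∑ᶠ j, c j * μ j) → (∃ μ : J →₀ S, ∀ c : J → S,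
      ev (qcoh R (J →₀ R)) S (ofLin (J →₀ R) (Finsupp.linearCombination R c)) z' =
        ∑ᶠ j, c j * μ j) → ∃ μ : J →₀ S, ∀ c : J → S,
      ev (qcoh R (J →₀ R)) S (ofLin (J →₀ R) (Finsupp.linearCombination R c)) (z + z') =
        ∑ᶠ j, c j * μ j := by
    rintro z z' ⟨μ, hμ⟩ ⟨μ', hμ'⟩
    refine ⟨μ + μ', fun c => ?_⟩
    refine (map_add (ev (qcoh R (J →₀ R)) S _) z z').trans
      ((congrArg₂ (· + ·) (hμ c) (hμ' c)).trans ?_)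
    rw [← finsum_add_distrib (hfin _ _) (hfin _ _)]
    simp [mul_add]
  have hzero : ∃ μ : J →₀ S, ∀ c : J → S,
      ev (qcoh R (J →₀ R)) S (ofLin (J →₀ R) (Finsupp.linearCombination R c))
        (0 : S ⊗[R] (J →₀ R)) = ∑ᶠ j, c j * μ j :=
    ⟨0, fun c => (map_zero (ev (qcoh R (J →₀ R)) S _)).trans (by simp)⟩
  induction z with
  | zero => exact hzero
  | add z z' h h' => exact hadd z z' h h'
  | tmul s a =>
    induction a using Finsupp.induction_linear with
    | zero => rw [TensorProduct.tmul_zero]; exact hzero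
    | add a b h h' => rw [TensorProduct.tmul_add]; exact hadd _ _ h h'
    | single j r =>
      refine ⟨Finsupp.single j (r • s), fun c => ?_⟩
      refine (ev_map_ofLin_tmul (AlgHom.id R S) _ s _).trans ?_
      rw [finsum_eq_single _ j fun k hk => by rw [Finsupp.single_eq_of_ne hk, mul_zero]]
      simp [mul_comm]

/-- Every functional on `∏_J 𝓡` is a finite linear combination of the coordinates. -/
lemma exists_finsupp_ev_prodUnit {J : Type u} {S : CommAlgCat.{u} R}
    (g : (dual (prodUnit R J)).obj S) :
    ∃ μ : J →₀ S, ∀ c : J → S, ev (prodUnit R J) S g c = ∑ᶠ j, c j * μ j := by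
  -- Pulled back to (⊕_J 𝓡)*, `g` becomes an element of (⊕_J 𝓡)**, that is, of S ⊗ R^(J). The
  -- finiteness comes from there.
  obtain ⟨z, hz⟩ := (bidual_qcoh_isIso (R := R) (J →₀ R) S).2
    ((dualMap (dualFinsuppCoord J)).app S g)
  obtain ⟨μ, hμ⟩ := exists_finsupp_ev_ofLin J S z
  refine ⟨μ, fun c => ?_⟩
  rw [← hμ, ← ev_bidual, hz, ev_dualMap]
  refine congrArg (ev (prodUnit R J) S g) (funext fun j => ?_)
  refine Eq.symm ((ev_map_ofLin_tmul (AlgHom.id R S) _ 1 _).trans ?_)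
  simp

/-- The `i`-th coordinate functional. -/
def coordFun {X : ModFun.{u, v} R} {I : Type u} (ι : Hom X (prodUnit R I))
    (S : CommAlgCat.{u} R) (i : I) : (dual X).obj S :=
  ofEv X (fun T _ =>
    { toFun := fun x => (show I → T from ι.app T x) i
      map_add' := fun x y => congrFun (map_add (ι.app T) x y) i
      map_smul' := fun r x => congrFun (map_smul (ι.app T) r x) i })
    fun _ _ _ ψ x => congrFun (ι.naturality ψ x) i

/-- The `i`-th coordinate of `x`. -/
def coef {X : ModFun.{u, v} R} {I : Type u} (ι : Hom X (prodUnit R I))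
    {S : CommAlgCat.{u} R} (i : I) : X.obj S →ₗ[S] S :=
  ev X S (coordFun ι S i)

lemma coef_map {X : ModFun.{u, v} R} {I : Type u} (ι : Hom X (prodUnit R I))
    {S T : CommAlgCat.{u} R} (φ : S →ₐ[R] T) (i : I) (x : X.obj S) :
    coef ι i (X.map φ x) = φ (coef ι i x) :=
  congrFun (ι.naturality φ x) i

lemma app_eq_iff_coef {X : ModFun.{u, v} R} {I : Type u} (ι : Hom X (prodUnit R I))
    {S : CommAlgCat.{u} R} {x y : X.obj S} :
    ι.app S x = ι.app S y ↔ ∀ i, coef ι i x = coef ι i y :=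
  funext_iff

/-! ### Expansions, frames and their duals. -/

/-- A functor of modules whose functionals are finite linear combinations of coordinates. -/
structure Expansion (X : ModFun.{u, v} R) (I : Type u) where
  coord : Hom X (prodUnit R I)
  vec : ∀ S : CommAlgCat.{u} R, I → X.obj S
  map_vec : ∀ {S T : CommAlgCat.{u} R} (φ : S →ₐ[R] T) (i : I), X.map φ (vec S i) = vec T i
  coef_vec : ∀ (S : CommAlgCat.{u} R) (i k : I),
    coef coord k (vec S i) = (Pi.single i 1 : I → S) k
  finite : ∀ (S : CommAlgCat.{u} R) (f : (dual X).obj S) (x : X.obj S),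
    (Function.support fun i => coef coord i x * ev X S f (vec S i)).Finite
  ev_eq : ∀ (S : CommAlgCat.{u} R) (f : (dual X).obj S) (x : X.obj S),
    ev X S f x = ∑ᶠ i, coef coord i x * ev X S f (vec S i)

/-- An expansion with faithful coordinates, stable under multiplication by `∏_I 𝓡`. -/
structure Frame (X : ModFun.{u, v} R) (I : Type u) extends Expansion X I where
  injective : ∀ S, Function.Injective (coord.app S)
  stable : ∀ (S : CommAlgCat.{u} R) (c : I → S) (x : X.obj S),
    ∃ y, ∀ i, coef coord i y = c i * coef coord i x

lemma Frame.ext_coef {X : ModFun.{u, v} R} {I : Type u} (E : Frame X I)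
    {S : CommAlgCat.{u} R} {x y : X.obj S} (h : ∀ i, coef E.coord i x = coef E.coord i y) :
    x = y :=
  E.injective S ((app_eq_iff_coef E.coord).2 h)

/-- The assignment c ↦ f(c·x) is a functional on all of ∏_I 𝓡, even though X may be smaller.
Injectivity of the coordinates makes c·x unique, hence linear in c and compatible with base change.
Finiteness on the product thus passes to X. -/
lemma exists_scale {X : ModFun.{u, v} R} {I : Type u} {ι : Hom X (prodUnit R I)}
    (hinj : ∀ S, Function.Injective (ι.app S))
    (hst : ∀ (S : CommAlgCat.{u} R) (c : I → S) (x : X.obj S),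
      ∃ y, ∀ i, coef ι i y = c i * coef ι i x)
    {S : CommAlgCat.{u} R} (f : (dual X).obj S) (x : X.obj S) :
    ∃ g : (dual (prodUnit R I)).obj S, ∀ (c : I → S) (y : X.obj S),
      (∀ i, coef ι i y = c i * coef ι i x) → ev (prodUnit R I) S g c = ev X S f y := by
  have hext : ∀ {S : CommAlgCat.{u} R} {x y : X.obj S}, (∀ i, coef ι i x = coef ι i y) → x = y :=
    fun h => hinj _ ((app_eq_iff_coef ι).2 h)
  choose y hy using hst
  have hadd : ∀ (T : CommAlgCat.{u} R) (c c' : I → T) (x : X.obj T),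
      y T (c + c') x = y T c x + y T c' x := fun T c c' x => hext fun i => by
    simp [hy, add_mul]
  have hsmul : ∀ (T : CommAlgCat.{u} R) (t : T) (c : I → T) (x : X.obj T),
      y T (t • c) x = t • y T c x := fun T t c x => hext fun i => by
    simp [hy, mul_assoc]
  refine ⟨ofEv (prodUnit R I) (fun T φ =>
    { toFun := fun c => ev X T ((dual X).map φ f) (y T c (X.map φ x))
      map_add' := fun c c' => (congrArg _ (hadd T c c' _)).trans (map_add _ _ _)
      map_smul' := fun t c => (congrArg _ (hsmul T t c _)).trans (map_smul _ _ _) })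
    fun T U φ ψ c => ?_, fun c z hz => ?_⟩
  · refine Eq.trans ?_ (ev_map X ψ ((dual X).map φ f) (y T c (X.map φ x)))
    refine congrArg (ev X U ((dual X).map (ψ.comp φ) f)) (hext fun i => ?_)
    rw [coef_map]
    refine (hy U _ _ i).trans (Eq.trans ?_ (congrArg ψ (hy T c _ i)).symm)
    rw [map_mul]
    exact congrArg (fun u => ψ (c i) * u) (by rw [X.map_comp, coef_map])
  · refine congrArg (ev X S f) (hext fun i => ?_)
    rw [hz]
    refine (hy S c _ i).trans ?_
    rw [X.map_id]

/-- A subfunctor of `∏_I 𝓡` which contains `⊕_I 𝓡` and is stable under `∏_I 𝓡` has a frame. -/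
lemma exists_frame {X : ModFun.{u, v} R} {I : Type u} (ι : Hom X (prodUnit R I))
    (hinj : ∀ S, Function.Injective (ι.app S))
    (hfin : ∀ (S : CommAlgCat.{u} R) (i : I), ∃ x : X.obj S,
      ∀ k, coef ι k x = (Pi.single i 1 : I → S) k)
    (hst : ∀ (S : CommAlgCat.{u} R) (c : I → S) (x : X.obj S),
      ∃ y, ∀ i, coef ι i y = c i * coef ι i x) :
    ∃ E : Frame X I, E.coord = ι := by
  have hext : ∀ {S : CommAlgCat.{u} R} {x y : X.obj S}, (∀ i, coef ι i x = coef ι i y) → x = y :=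
    fun h => hinj _ ((app_eq_iff_coef ι).2 h)
  choose e he using hfin
  have key : ∀ (S : CommAlgCat.{u} R) (f : (dual X).obj S) (x : X.obj S), ∃ μ : I →₀ S,
      (∀ i, coef ι i x * ev X S f (e S i) = μ i) ∧ ev X S f x = ∑ᶠ i, μ i := by
    intro S f x
    obtain ⟨g, hg⟩ := exists_scale hinj hst f x
    obtain ⟨μ, hμ⟩ := exists_finsupp_ev_prodUnit g
    refine ⟨μ, fun i => ?_, ?_⟩
    -- Testing at c = δ_i isolates the coefficient, since δ_i·x = x_i e_i. Testing at c = 1 below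
    -- recovers f(x).
    · have h1 : ev (prodUnit R I) S g (Pi.single i 1 : I → S) = μ i := by
        rw [hμ, finsum_eq_single _ i fun k hk => by simp [hk]]
        simp
      rw [← h1, hg _ (coef ι i x • e S i) fun k => ?_, map_smul, smul_eq_mul]
      rw [map_smul, he, smul_eq_mul]
      by_cases hk : k = i
      · subst hk; simp
      · simp [hk]
    · rw [← hg 1 x fun i => by simp, hμ]
      simp
  refine ⟨⟨⟨ι, e, fun φ i => hext fun k => ?_, he, fun S f x => ?_, fun S f x => ?_⟩, hinj, hst⟩, rfl⟩
  · rw [coef_map, he, he]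
    by_cases hk : k = i
    · subst hk; simp
    · simp [hk]
  · obtain ⟨μ, hμ, -⟩ := key S f x
    simp only [hμ]
    exact μ.support.finite_toSet.subset fun i hi => Finsupp.mem_support_iff.2 hi
  · obtain ⟨μ, hμ, h⟩ := key S f x
    simp only [hμ, h]

lemma InF.exists_frame {M : ModFun.{u, u + 1} R} (h : InF M) :
    ∃ J : Type u, Nonempty (Frame M J) := by
  obtain ⟨-, J, ι, hinj, hfin, hst⟩ := h
  obtain ⟨E, -⟩ := RFunctor.exists_frame ι hinj
    (fun S i => (hfin S (Pi.single i 1) ((Set.finite_singleton i).subset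
      Pi.support_single_subset)).imp fun x hx k => congrFun hx k)
    fun S c x => (hst S c x).imp fun y hy k => congrFun hy k
  exact ⟨J, ⟨E⟩⟩

lemma Frame.inF {M : ModFun.{u, u + 1} R} {J : Type u} (E : Frame M J) (h : IsDual M) : InF M := by
  refine ⟨h, J, E.coord, E.injective, fun S x hx => ?_, fun S c m => ?_⟩
  · refine ⟨∑ i ∈ hx.toFinset, x i • E.vec S i, funext fun k => ?_⟩
    change coef E.coord k (∑ i ∈ hx.toFinset, x i • E.vec S i) = x k
    simp only [map_sum, map_smul, E.coef_vec, smul_eq_mul]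
    rw [Finset.sum_eq_single k]
    · simp
    · intro i _ hi; simp [hi.symm]
    · intro hk; simp at hk; simp [hk]
  · obtain ⟨y, hy⟩ := E.stable S c m
    exact ⟨y, funext hy⟩

/-- The coordinates of a functional. -/
def Expansion.dualCoord {X : ModFun.{u, v} R} {I : Type u} (E : Expansion X I) :
    Hom (dual X) (prodUnit R I) where
  app S :=
    { toFun := fun f i => ev X S f (E.vec S i)
      map_add' := fun _ _ => rfl
      map_smul' := fun _ _ => rfl }
  naturality {S T} φ f := funext fun i => by
    refine (congrArg (ev X T ((dual X).map φ f)) (E.map_vec φ i).symm).trans ?_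
    exact ev_map X φ f (E.vec S i)

/-- By the expansion f(x) = Σ x_i f(e_i), applied over every T; the e_i over T come from S, so their
values over S suffice. -/
lemma Expansion.dual_ext {X : ModFun.{u, v} R} {I : Type u} (E : Expansion X I)
    {S : CommAlgCat.{u} R} {f g : (dual X).obj S}
    (h : ∀ i, ev X S f (E.vec S i) = ev X S g (E.vec S i)) : f = g :=
  RFunctor.dual_ext fun T φ x => by
    rw [E.ev_eq, E.ev_eq]
    refine finsum_congr fun i => ?_
    rw [← E.map_vec φ, ev_map, ev_map, h]

/-- The functional with coordinates `c i * f i`. -/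
def Expansion.scaleDual {X : ModFun.{u, v} R} {I : Type u} (E : Expansion X I)
    {S : CommAlgCat.{u} R} (c : I → S) (f : (dual X).obj S) : (dual X).obj S :=
  -- Multiplying the terms by arbitrary c_i cannot enlarge the finite support of x_i f(e_i). This is
  -- why duals are stable under ∏_I 𝓡.
  have hfin : ∀ (T : CommAlgCat.{u} R) (φ : S →ₐ[R] T) (x : X.obj T), (Function.support fun i =>
      φ (c i) * (coef E.coord i x * ev X T ((dual X).map φ f) (E.vec T i))).Finite :=
    fun T φ x => (E.finite T ((dual X).map φ f) x).subset fun i hi => right_ne_zero_of_mul hi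
  ofEv X (fun T φ =>
    { toFun := fun x => ∑ᶠ i, φ (c i) * (coef E.coord i x * ev X T ((dual X).map φ f) (E.vec T i))
      map_add' := fun x y => by
        rw [← finsum_add_distrib (hfin T φ x) (hfin T φ y)]
        exact finsum_congr fun i => by rw [map_add]; ring
      map_smul' := fun t x => by
        rw [RingHom.id_apply, smul_eq_mul, mul_finsum' _ _ (hfin T φ x)]
        exact finsum_congr fun i => by rw [map_smul, smul_eq_mul]; ring })
    fun T U φ ψ x => by
      change ∑ᶠ i, _ = ψ (∑ᶠ i, _)
      rw [map_finsum ψ (hfin T φ x)]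
      refine finsum_congr fun i => ?_
      rw [coef_map, ← E.map_vec ψ, map_mul, map_mul, ← ev_map]
      rfl

/-- Dualizing upgrades an expansion to a frame: X itself need not embed in ∏_I 𝓡 nor be stable. This
matters for tensor products, which are only given an expansion. -/
lemma Expansion.exists_frame_dual {X : ModFun.{u, v} R} {I : Type u} (E : Expansion X I) :
    ∃ F : Frame (dual X) I, F.coord = E.dualCoord := by
  refine RFunctor.exists_frame E.dualCoord (fun S f g h => E.dual_ext (congrFun h))
    (fun S i => ⟨coordFun E.coord S i, fun k => ?_⟩) fun S c f => ⟨E.scaleDual c f, fun i => ?_⟩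
  · refine (E.coef_vec S k i).trans ?_
    by_cases hk : k = i
    · subst hk; simp
    · simp [hk, Ne.symm hk]
  · change ∑ᶠ k, _ = _
    rw [finsum_eq_single _ i fun k hk => ?_]
    · rw [E.coef_vec, Pi.single_eq_same, one_mul]; rfl
    · rw [E.coef_vec, Pi.single_eq_of_ne hk, zero_mul, mul_zero]

/-- The frame of the dual. -/
def Expansion.dualFrame {X : ModFun.{u, v} R} {I : Type u} (E : Expansion X I) :
    Frame (dual X) I := E.exists_frame_dual.choose

lemma Expansion.coef_dualFrame {X : ModFun.{u, v} R} {I : Type u} (E : Expansion X I)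
    {S : CommAlgCat.{u} R} (f : (dual X).obj S) (i : I) :
    coef E.dualFrame.coord i f = ev X S f (E.vec S i) := by
  rw [dualFrame, E.exists_frame_dual.choose_spec]
  rfl

/-- Coordinates determine the vectors of a frame, so the choice made in `dualFrame` is harmless: its
vectors are the dual basis. -/
lemma Expansion.dualFrame_vec {X : ModFun.{u, v} R} {I : Type u} (E : Expansion X I)
    (S : CommAlgCat.{u} R) (i : I) : E.dualFrame.vec S i = coordFun E.coord S i := by
  refine E.dual_ext fun k => ?_
  rw [← coef_dualFrame, E.dualFrame.coef_vec]
  refine Eq.trans ?_ (E.coef_vec S k i).symm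
  by_cases hk : k = i
  · subst hk; simp
  · simp [hk, Ne.symm hk]

lemma Expansion.dualFrame_dualFrame_vec {X : ModFun.{u, v} R} {I : Type u} (E : Expansion X I)
    (S : CommAlgCat.{u} R) (i : I) :
    E.dualFrame.dualFrame.vec S i = (bidual X).app S (E.vec S i) := by
  refine E.dualFrame.toExpansion.dual_ext fun k => ?_
  rw [E.dualFrame.dualFrame_vec, ev_bidual]
  exact E.coef_dualFrame _ i

/-! ### Tensor products of frames. -/

/-- The coordinates `x ⊗ y ↦ x i * y k`. -/
def tensorCoord {X : ModFun.{u, v} R} {Y : ModFun.{u, w} R} {I K : Type u}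
    (ι : Hom X (prodUnit R I)) (κ : Hom Y (prodUnit R K)) :
    Hom (tensor X Y) (prodUnit R (I × K)) where
  app S := LinearMap.pi fun p => TensorProduct.lift
    ((LinearMap.mul S S).compl₁₂ (coef ι p.1) (coef κ p.2))
  naturality {S T} φ x := funext fun p => by
    let F : X.obj S ⊗[S] Y.obj S →+ T :=
      (TensorProduct.lift ((LinearMap.mul T T).compl₁₂ (coef ι p.1)
        (coef κ p.2))).toAddMonoidHom.comp ((tensor X Y).map φ).toAddMonoidHom
    let G : X.obj S ⊗[S] Y.obj S →+ T :=
      (φ : S →+ T).comp (TensorProduct.lift ((LinearMap.mul S S).compl₁₂ (coef ι p.1)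
        (coef κ p.2))).toAddMonoidHom
    suffices H : ∀ x : X.obj S ⊗[S] Y.obj S, F x = G x from H x
    intro x
    induction x with
    | zero => rw [map_zero, map_zero]
    | add x y hx hy => rw [map_add, map_add, hx, hy]
    | tmul x y =>
      change coef ι p.1 (X.map φ x) * coef κ p.2 (Y.map φ y) = φ (coef ι p.1 x * coef κ p.2 y)
      rw [coef_map, coef_map, map_mul]

lemma coef_tensorCoord {X : ModFun.{u, v} R} {Y : ModFun.{u, w} R} {I K : Type u}
    (ι : Hom X (prodUnit R I)) (κ : Hom Y (prodUnit R K)) {S : CommAlgCat.{u} R} (p : I × K)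
    (x : X.obj S) (y : Y.obj S) :
    coef (tensorCoord ι κ) p (x ⊗ₜ[S] y) = coef ι p.1 x * coef κ p.2 y := rfl

/-- The universal `S`-algebra with a family of elements indexed by `K`. -/
lemma exists_generic_family (S : CommAlgCat.{u} R) (K : Type u) :
    ∃ (U : CommAlgCat.{u} R) (φ : S →ₐ[R] U) (ξ : K → U), ∀ c : K → S, ∃ ψ : U →ₐ[R] S,
      ψ.comp φ = AlgHom.id R S ∧ ∀ k, ψ (ξ k) = c k :=
  ⟨CommAlgCat.of R (MvPolynomial K S), IsScalarTower.toAlgHom R S (MvPolynomial K S),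
    fun k => (MvPolynomial.X k : MvPolynomial K S), fun c =>
      ⟨(MvPolynomial.aeval c : MvPolynomial K S →ₐ[S] S).restrictScalars R,
        AlgHom.ext fun s => MvPolynomial.aeval_C c s, fun k => MvPolynomial.aeval_X c k⟩⟩

/-- Expanding in one variable at a time bounds k for each i, but not i uniformly in k. Rescaling `y`
by independent indeterminates ξ_k handles all k at once: an index i outside the finite support for
the rescaled vector contributes nothing for any k. -/
lemma Frame.finite_tensor {X : ModFun.{u, v} R} {Y : ModFun.{u, w} R} {I K : Type u}
    (E : Frame X I) (F : Frame Y K) {S : CommAlgCat.{u} R} (s : (dual (tensor X Y)).obj S)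
    (x : X.obj S) (y : Y.obj S) :
    (Function.support fun p : I × K => (coef E.coord p.1 x * coef F.coord p.2 y) *
      ev (tensor X Y) S s (E.vec S p.1 ⊗ₜ[S] F.vec S p.2)).Finite := by
  obtain ⟨U, φ, ξ, hξ⟩ := exists_generic_family S K
  obtain ⟨y', hy'⟩ := F.stable U ξ (Y.map φ y)
  have hA := E.finite U (evalRight ((dual (tensor X Y)).map φ s) y') (X.map φ x)
  have hB : ∀ i, _ := fun i => F.finite S (evalLeft s (E.vec S i)) y
  refine (hA.biUnion fun i _ => (hB i).image (Prod.mk i)).subset ?_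
  rintro ⟨i, k⟩ hik
  have hik' : coef E.coord i x * (coef F.coord k y *
      ev (tensor X Y) S s (E.vec S i ⊗ₜ[S] F.vec S k)) ≠ 0 := by rwa [← mul_assoc]
  refine Set.mem_biUnion (x := i) (fun h0 => hik' ?_) ⟨k, ?_, rfl⟩
  -- Specializing ξ to δ_k turns the rescaled vector into y_k e_k, so the vanishing over `U` yields
  -- the vanishing of the (i, k) term over `S`.
  · obtain ⟨ψ, hψ, hψξ⟩ := hξ (Pi.single k 1)
    have hX : ∀ x : X.obj S, X.map ψ (X.map φ x) = x := fun x => by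
      rw [← X.map_comp, hψ, X.map_id]
    have hY : Y.map ψ y' = coef F.coord k y • F.vec S k := F.ext_coef fun l => by
      rw [coef_map, hy', map_mul, hψξ, map_smul, F.coef_vec, coef_map,
        ← AlgHom.comp_apply, hψ, AlgHom.id_apply, smul_eq_mul]
      by_cases hl : l = k
      · subst hl; simp
      · simp [hl]
    have h1 := congrArg ψ h0
    have h2 := ev_map X ψ (evalRight ((dual (tensor X Y)).map φ s) y') (E.vec U i)
    rw [map_evalRight, hY, E.map_vec, ← (dual (tensor X Y)).map_comp, hψ,
      (dual (tensor X Y)).map_id, ev_evalRight] at h2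
    simp only [map_mul, map_zero, ← h2] at h1
    rw [coef_map, ← AlgHom.comp_apply, hψ, AlgHom.id_apply] at h1
    refine Eq.trans ?_ h1
    refine congrArg (fun t => coef E.coord i x * t) ?_
    refine (map_smul (ev (tensor X Y) S s) (coef F.coord k y) _).symm.trans ?_
    exact congrArg (ev (tensor X Y) S s) (TensorProduct.tmul_smul _ _ _).symm
  · have := right_ne_zero_of_mul hik'
    rwa [← ev_evalLeft] at this

/-- Expansion in `x` and then in `y`; joint finiteness allows the iterated sum to be merged into
one. -/
lemma Frame.ev_tensor_eq {X : ModFun.{u, v} R} {Y : ModFun.{u, w} R} {I K : Type u}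
    (E : Frame X I) (F : Frame Y K) {S : CommAlgCat.{u} R} (s : (dual (tensor X Y)).obj S)
    (x : X.obj S) (y : Y.obj S) :
    ev (tensor X Y) S s (x ⊗ₜ[S] y) = ∑ᶠ p : I × K, (coef E.coord p.1 x * coef F.coord p.2 y) *
      ev (tensor X Y) S s (E.vec S p.1 ⊗ₜ[S] F.vec S p.2) := by
  rw [finsum_curry _ (E.finite_tensor F s x y), ← ev_evalRight, E.ev_eq]
  refine finsum_congr fun i => ?_
  rw [ev_evalRight, ← ev_evalLeft, F.ev_eq, mul_finsum' _ _ (F.finite S _ _)]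
  refine finsum_congr fun k => ?_
  rw [ev_evalLeft, mul_assoc]

/-- The expansion of a tensor product of frames. -/
def Frame.tensor {X : ModFun.{u, v} R} {Y : ModFun.{u, w} R} {I K : Type u}
    (E : Frame X I) (F : Frame Y K) : Expansion (tensor X Y) (I × K) :=
  have key : ∀ (S : CommAlgCat.{u} R) (s : (dual (RFunctor.tensor X Y)).obj S)
      (x : X.obj S ⊗[S] Y.obj S),
      (Function.support fun p : I × K => coef (tensorCoord E.coord F.coord) p x *
        ev (RFunctor.tensor X Y) S s (E.vec S p.1 ⊗ₜ[S] F.vec S p.2)).Finite ∧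
      ev (RFunctor.tensor X Y) S s x = ∑ᶠ p : I × K, coef (tensorCoord E.coord F.coord) p x *
        ev (RFunctor.tensor X Y) S s (E.vec S p.1 ⊗ₜ[S] F.vec S p.2) := fun S s x => by
    induction x with
    | zero =>
      have h : ∀ p : I × K, coef (tensorCoord E.coord F.coord) p
          (0 : X.obj S ⊗[S] Y.obj S) = 0 := fun p => map_zero (coef _ p)
      simp only [h, zero_mul, finsum_zero]
      exact ⟨by simp [Function.support], map_zero (ev (RFunctor.tensor X Y) S s)⟩
    | tmul x y => exact ⟨E.finite_tensor F s x y, E.ev_tensor_eq F s x y⟩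
    | add x y hx hy =>
      have h : ∀ p : I × K, coef (tensorCoord E.coord F.coord) p (x + y) =
          coef (tensorCoord E.coord F.coord) p x + coef (tensorCoord E.coord F.coord) p y :=
        fun p => map_add (coef (tensorCoord E.coord F.coord) p) x y
      simp only [h, add_mul]
      refine ⟨(hx.1.union hy.1).subset (Function.support_add _ _), ?_⟩
      rw [finsum_add_distrib hx.1 hy.1, ← hx.2, ← hy.2]
      exact map_add (ev (RFunctor.tensor X Y) S s) x y
  { coord := tensorCoord E.coord F.coord
    vec := fun S p => E.vec S p.1 ⊗ₜ[S] F.vec S p.2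
    map_vec := fun {S T} φ p => by
      refine Eq.trans ?_ (congrArg₂ (fun x y => x ⊗ₜ[T] y) (E.map_vec φ p.1) (F.map_vec φ p.2))
      rfl
    coef_vec := fun S p q => by
      rw [coef_tensorCoord, E.coef_vec, F.coef_vec]
      by_cases h : q = p
      · subst h; simp
      · by_cases h1 : q.1 = p.1
        · have h2 : q.2 ≠ p.2 := fun h2 => h (Prod.ext h1 h2)
          simp [h, h2]
        · simp [h, h1]
    finite := fun S s x => (key S s x).1
    ev_eq := fun S s x => (key S s x).2 }

/-! ### Reflexivity -/

/-- A dual functor with a frame is reflexive. -/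
lemma Frame.bidual_isIso {M : ModFun.{u, u + 1} R} {J : Type u} (E : Frame M J)
    (hM : IsDual M) : (bidual M).IsIso := by
  obtain ⟨N, e, he⟩ := hM
  -- Any dual M = N* is a retract of M**, by dualizing N → N**. The frame is needed only to see that
  -- the retraction is injective.
  let r : Hom (dual (dual M)) M :=
    (e.inv he).comp ((dualMap (bidual N)).comp (dualMap (dualMap e)))
  have hr : ∀ S x, r.app S ((bidual M).app S x) = x := fun S x => by
    refine Eq.trans (congrArg ((e.inv he).app S) (RFunctor.dual_ext fun T φ y => ?_))
      (e.inv_app_app he x)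
    rw [← Hom.naturality, ← Hom.naturality, ← Hom.naturality, Hom.comp_app, ev_dualMap,
      ev_dualMap, ev_bidual, ev_dualMap, ev_bidual]
  refine Hom.IsIso.of_inverse r hr fun S F => ?_
  -- Functionals on M** are determined by their values on the images of the e_k under M → M**, where
  -- `r` returns e_k.
  have key : ∀ j, (dualMap r).app S (coordFun E.coord S j) =
      (bidual (dual M)).app S (coordFun E.coord S j) := fun j => by
    refine E.dualFrame.dualFrame.toExpansion.dual_ext fun k => ?_
    rw [E.dualFrame_dualFrame_vec, ev_dualMap, ev_bidual, ev_bidual, hr]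
  refine E.dualFrame.toExpansion.dual_ext fun j => ?_
  rw [E.dualFrame_vec, ev_bidual, ← ev_dualMap, key, ev_bidual]

end Frames

/-! ### The algebra structure of the completed tensor product -/

section Limit

lemma bidual_naturality {M : ModFun.{u, v} R} {N : ModFun.{u, w} R} (f : Hom M N)
    {S : CommAlgCat.{u} R} (x : M.obj S) :
    (dualMap (dualMap f)).app S ((bidual M).app S x) = (bidual N).app S (f.app S x) :=
  dual_ext fun T φ g => by
    rw [← Hom.naturality, ← Hom.naturality, ← Hom.naturality, ← Hom.naturality, ev_dualMap,
      ev_bidual, ev_dualMap, ev_bidual]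

lemma toCtensor_naturality {M : ModFun.{u, v} R} {M' : ModFun.{u, v'} R} {N : ModFun.{u, w} R}
    {N' : ModFun.{u, w'} R} (f : Hom M M') (g : Hom N N') {S : CommAlgCat.{u} R}
    (x : (tensor M N).obj S) :
    (ctensorMap f g).app S ((toCtensor M N).app S x) =
      (toCtensor M' N').app S ((tensorMap f g).app S x) := by
  let F : M.obj S ⊗[S] N.obj S →ₗ[S] (ctensor M' N').obj S :=
    ((ctensorMap f g).comp (toCtensor M N)).app S
  let G : M.obj S ⊗[S] N.obj S →ₗ[S] (ctensor M' N').obj S :=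
    ((toCtensor M' N').comp (tensorMap f g)).app S
  refine LinearMap.congr_fun (TensorProduct.ext' fun x y => ?_ : F = G) x
  refine tensor_dual_ext fun T φ h k => ?_
  have e1 : (dual (tensor (dual M') (dual N'))).map φ (F (x ⊗ₜ[S] y)) =
      (ctensorMap f g).app T ((toCtensor M N).app T (M.map φ x ⊗ₜ[T] N.map φ y)) := by
    refine (((ctensorMap f g).comp (toCtensor M N)).naturality φ (x ⊗ₜ[S] y)).symm.trans ?_
    rfl
  have e2 : (dual (tensor (dual M') (dual N'))).map φ (G (x ⊗ₜ[S] y)) =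
      (toCtensor M' N').app T (f.app T (M.map φ x) ⊗ₜ[T] g.app T (N.map φ y)) := by
    refine (((toCtensor M' N').comp (tensorMap f g)).naturality φ (x ⊗ₜ[S] y)).symm.trans ?_
    rfl
  rw [e1, e2]
  refine (ev_ctensorMap f g _ h k).trans ?_
  refine (ev_toCtensor _ _ _ _).trans (Eq.trans ?_ (ev_toCtensor _ _ _ _).symm)
  rw [ev_dualMap, ev_dualMap]

lemma qcohMap_id_eq (A : Type u) [AddCommGroup A] [Module R A] :
    qcohMap (LinearMap.id : A →ₗ[R] A) = Hom.id (qcoh R A) :=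
  Hom.ext_app (qcohMap_id A)

lemma isAlgHom_tensorMap_qcohMap {A A' B B' : Type u} [Ring A] [Algebra R A] [Ring A']
    [Algebra R A'] [Ring B] [Algebra R B] [Ring B'] [Algebra R B'] (f : A →ₐ[R] A')
    (g : B →ₐ[R] B') :
    IsAlgHom (qcohTensorAlg R A B) (qcohTensorAlg R A' B')
      (tensorMap (qcohMap f.toLinearMap) (qcohMap g.toLinearMap)) where
  map_mul S := map_mul (Algebra.TensorProduct.map
    (Algebra.TensorProduct.map (AlgHom.id S S) f) (Algebra.TensorProduct.map (AlgHom.id S S) g))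
  map_one S := map_one (Algebra.TensorProduct.map
    (Algebra.TensorProduct.map (AlgHom.id S S) f) (Algebra.TensorProduct.map (AlgHom.id S S) g))

/-- An algebra structure is induced by a jointly injective family of morphisms to functors of
algebras whose image is closed under the operations. -/
lemma exists_algStr_of_family {Z : ModFun.{u, v} R} {ι : Sort*} {W : ι → ModFun.{u, w} R}
    (b : ∀ i, AlgStr (W i)) (π : ∀ i, Hom Z (W i))
    (hinj : ∀ (S : CommAlgCat.{u} R) (x y : Z.obj S),
      (∀ i, (π i).app S x = (π i).app S y) → x = y)
    (hmul : ∀ (S : CommAlgCat.{u} R) (x y : Z.obj S),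
      ∃ z, ∀ i, (π i).app S z = (b i).mul S ((π i).app S x) ((π i).app S y))
    (hone : ∀ S : CommAlgCat.{u} R, ∃ z, ∀ i, (π i).app S z = (b i).one S) :
    ∃ t : AlgStr Z, ∀ i, IsAlgHom t (b i) (π i) := by
  choose m hm using hmul
  choose e he using hone
  refine ⟨{ mul := fun S => LinearMap.mk₂ S (m S)
              (fun x y z => hinj S _ _ fun i => by simp [hm])
              (fun r x y => hinj S _ _ fun i => by simp [hm])
              (fun x y z => hinj S _ _ fun i => by simp [hm])
              (fun r x y => hinj S _ _ fun i => by simp [hm])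
            one := e
            mul_assoc := fun S x y z => hinj S _ _ fun i => by simp [hm, (b i).mul_assoc]
            one_mul := fun S x => hinj S _ _ fun i => by simp [hm, he, (b i).one_mul]
            mul_one := fun S x => hinj S _ _ fun i => by simp [hm, he, (b i).mul_one]
            map_mul := fun φ x y => hinj _ _ _ fun i => by
              simp [hm, Hom.naturality, (b i).map_mul]
            map_one := fun φ => hinj _ _ _ fun i => by
              simp [he, Hom.naturality, (b i).map_one] }, fun i => ⟨fun S x y => hm S x y i,
                fun S => he S i⟩⟩

/-! ### Bilinear forms as limits over quasi-coherent quotients. -/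

variable {M : ModFun.{u, v} R} {a : AlgStr M}

/-- The condition that `f` is a morphism of quotients. -/
def QCohAlgQuot.IsMor (P P' : QCohAlgQuot a) (f : P.A →ₐ[R] P'.A) : Prop :=
  (qcohMap f.toLinearMap).comp P.proj = P'.proj

lemma QCohAlgQuot.isMor_id (P : QCohAlgQuot a) : P.IsMor P (AlgHom.id R P.A) :=
  Hom.ext_app fun S x => qcohMap_id P.A S (P.proj.app S x)

/-- By reflexivity both elements come from M, whose points are separated by its quotients. -/
lemma bidual_quot_ext (hM : (bidual M).IsIso) (ha : IsProquasiCoherent a) {S : CommAlgCat.{u} R}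
    {F G : (dual (dual M)).obj S}
    (h : ∀ P : QCohAlgQuot a, (dualMap (dualMap P.proj)).app S F =
      (dualMap (dualMap P.proj)).app S G) : F = G := by
  obtain ⟨x, rfl⟩ := (hM S).2 F
  obtain ⟨y, rfl⟩ := (hM S).2 G
  refine congrArg ((bidual M).app S) ?_
  obtain ⟨z, -, hz⟩ := ha S (fun P => P.proj.app S y) fun P P' f hf => Hom.congr_app hf S y
  rw [hz x fun P => (bidual_qcoh_isIso P.A S).1 ?_, hz y fun P => rfl]
  rw [← bidual_naturality, ← bidual_naturality, h]

/-- `M** = lim 𝓐ᵢ**`. -/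
lemma exists_bidual_quot (ha : IsProquasiCoherent a)
    {S : CommAlgCat.{u} R} (z : ∀ P : QCohAlgQuot a, (dual (dual (qcoh R P.A))).obj S)
    (hz : ∀ (P P' : QCohAlgQuot a) (f : P.A →ₐ[R] P'.A), P.IsMor P' f →
      (dualMap (dualMap (qcohMap f.toLinearMap))).app S (z P) = z P') :
    ∃ F : (dual (dual M)).obj S, ∀ P : QCohAlgQuot a,
      (dualMap (dualMap P.proj)).app S F = z P := by
  obtain ⟨m, hm, -⟩ := ha S (fun P => ((bidual (qcoh R P.A)).inv (bidual_qcoh_isIso P.A)).app S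
    (z P)) fun P P' f hf => (bidual_qcoh_isIso P'.A S).1 <| by
      rw [← bidual_naturality, Hom.app_inv_app, Hom.app_inv_app, hz P P' f hf]
  exact ⟨(bidual M).app S m, fun P => by rw [bidual_naturality, hm, Hom.app_inv_app]⟩

/-- Restriction of a bilinear form along a morphism in the left variable. -/
abbrev restrictLeft {X : ModFun.{u, v} R} {X' : ModFun.{u, w} R} (f : Hom X X')
    (Y : ModFun.{u, w'} R) : Hom (dual (tensor X' Y)) (dual (tensor X Y)) :=
  dualMap (tensorMap f (Hom.id Y))

lemma ev_restrictLeft {X : ModFun.{u, v} R} {X' : ModFun.{u, w} R} (f : Hom X X')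
    (Y : ModFun.{u, w'} R) {S : CommAlgCat.{u} R} (s : (dual (tensor X' Y)).obj S) (x : X.obj S)
    (y : Y.obj S) :
    ev (tensor X Y) S ((restrictLeft f Y).app S s) (x ⊗ₜ[S] y) =
      ev (tensor X' Y) S s (f.app S x ⊗ₜ[S] y) := rfl

lemma evalRight_restrictLeft {X : ModFun.{u, v} R} {X' : ModFun.{u, w} R} (f : Hom X X')
    (Y : ModFun.{u, w'} R) {S : CommAlgCat.{u} R} (s : (dual (tensor X' Y)).obj S) (y : Y.obj S) :
    evalRight ((restrictLeft f Y).app S s) y = (dualMap f).app S (evalRight s y) :=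
  dual_ext fun T φ x => by
    rw [map_evalRight, ev_evalRight, ← Hom.naturality, ← Hom.naturality, map_evalRight,
      ev_dualMap, ev_evalRight, ev_restrictLeft]

/-- Fixing the second variable turns a form on M* × X into elements of M**, where the quotients
separate points. -/
lemma bilin_quot_ext (hM : (bidual M).IsIso) (ha : IsProquasiCoherent a) {X : ModFun.{u, w} R}
    {S : CommAlgCat.{u} R} {s t : (dual (tensor (dual M) X)).obj S}
    (h : ∀ P : QCohAlgQuot a, (restrictLeft (dualMap P.proj) X).app S s =
      (restrictLeft (dualMap P.proj) X).app S t) : s = t :=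
  tensor_dual_ext fun T φ f x => by
    rw [← ev_evalRight, ← ev_evalRight]
    refine congrArg (fun F => ev (dual M) T F f) (bidual_quot_ext hM ha fun P => ?_)
    rw [← evalRight_restrictLeft, ← evalRight_restrictLeft, Hom.naturality, Hom.naturality, h]

/-- `(M* ⊗ X)* = lim (𝓐ᵢ* ⊗ X)*`. -/
lemma exists_bilin_quot (hM : (bidual M).IsIso) (ha : IsProquasiCoherent a)
    {X : ModFun.{u, w} R} {S : CommAlgCat.{u} R}
    (y : ∀ P : QCohAlgQuot a, (dual (tensor (dual (qcoh R P.A)) X)).obj S)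
    (hy : ∀ (P P' : QCohAlgQuot a) (f : P.A →ₐ[R] P'.A), P.IsMor P' f →
      (restrictLeft (dualMap (qcohMap f.toLinearMap)) X).app S (y P) = y P') :
    ∃ s : (dual (tensor (dual M) X)).obj S, ∀ P : QCohAlgQuot a,
      (restrictLeft (dualMap P.proj) X).app S s = y P := by
  -- The partial functionals are glued for each fixed `x`. Linearity in `x` and naturality then
  -- follow from uniqueness of the gluing.
  have hex : ∀ (T : CommAlgCat.{u} R) (φ : S →ₐ[R] T) (x : X.obj T),
      ∃ F : (dual (dual M)).obj T, ∀ P : QCohAlgQuot a, (dualMap (dualMap P.proj)).app T F =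
        evalRight ((dual (tensor (dual (qcoh R P.A)) X)).map φ (y P)) x := fun T φ x => by
    refine exists_bidual_quot ha _ fun P P' f hf => ?_
    rw [← evalRight_restrictLeft, Hom.naturality, hy P P' f hf]
  choose F hF using hex
  refine ⟨ofBilin (dual M) X (fun T φ => LinearMap.mk₂ T (fun f x => ev (dual M) T (F T φ x) f)
    (fun f g x => map_add _ _ _) (fun r f x => map_smul _ _ _) (fun f x x' => ?_)
    (fun r f x => ?_)) fun T U φ ψ f x => ?_, fun P => ?_⟩
  · have h : F T φ (x + x') = F T φ x + F T φ x' :=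
      bidual_quot_ext hM ha fun P => by simp only [map_add, hF]
    rw [h]
    rfl
  · have h : F T φ (r • x) = r • F T φ x :=
      bidual_quot_ext hM ha fun P => by simp only [map_smul, hF]
    rw [h]
    rfl
  · have h : F U (ψ.comp φ) (X.map ψ x) = (dual (dual M)).map ψ (F T φ x) :=
      bidual_quot_ext hM ha fun P => by
        rw [Hom.naturality, hF, hF, map_evalRight, ← (dual _).map_comp]
    refine Eq.trans ?_ (ev_map (dual M) ψ (F T φ x) f)
    rw [← h]
    rfl
  · refine tensor_dual_ext fun T φ f x => ?_
    rw [← ev_evalRight _ f x, ← ev_evalRight _ f x, ← hF T φ x, ev_dualMap, ← Hom.naturality,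
      ev_evalRight, ev_restrictLeft]
    rfl

/-- The symmetry of the tensor product. -/
def tensorSwap (X : ModFun.{u, v} R) (Y : ModFun.{u, w} R) : Hom (tensor X Y) (tensor Y X) where
  app S := (TensorProduct.comm S (X.obj S) (Y.obj S)).toLinearMap
  naturality {S T} φ x := by
    let F : X.obj S ⊗[S] Y.obj S →+ Y.obj T ⊗[T] X.obj T :=
      (TensorProduct.comm T (X.obj T) (Y.obj T)).toLinearMap.toAddMonoidHom.comp
        ((tensor X Y).map φ).toAddMonoidHom
    let G : X.obj S ⊗[S] Y.obj S →+ Y.obj T ⊗[T] X.obj T :=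
      ((tensor Y X).map φ).toAddMonoidHom.comp
        (TensorProduct.comm S (X.obj S) (Y.obj S)).toLinearMap.toAddMonoidHom
    suffices H : ∀ x : X.obj S ⊗[S] Y.obj S, F x = G x from H x
    intro x
    induction x with
    | zero => rw [map_zero, map_zero]
    | add x y hx hy => rw [map_add, map_add, hx, hy]
    | tmul x y => rfl

variable {N : ModFun.{u, v} R} {b : AlgStr N}

/-- The one-variable statement is applied twice, the symmetry of the tensor product bringing the
second factor to the front. -/
lemma ctensor_quot_ext (hM : (bidual M).IsIso) (hN : (bidual N).IsIso)
    (ha : IsProquasiCoherent a) (hb : IsProquasiCoherent b) {S : CommAlgCat.{u} R}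
    {s t : (ctensor M N).obj S}
    (h : ∀ (P : QCohAlgQuot a) (Q : QCohAlgQuot b), (ctensorMap P.proj Q.proj).app S s =
      (ctensorMap P.proj Q.proj).app S t) : s = t := by
  refine bilin_quot_ext hM ha fun P => ?_
  have hinj : Function.Injective ((dualMap (tensorSwap (dual N) (dual (qcoh R P.A)))).app S) :=
    fun s t hst => tensor_dual_ext fun T φ x y =>
      congrArg (fun r => ev _ T ((dual (tensor (dual N) (dual (qcoh R P.A)))).map φ r)
        (y ⊗ₜ[T] x)) hst
  refine hinj (bilin_quot_ext hN hb fun Q => tensor_dual_ext fun T φ y x => ?_)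
  exact congrArg (fun r => ev _ T
    ((dual (tensor (dual (qcoh R P.A)) (dual (qcoh R Q.A)))).map φ r) (x ⊗ₜ[T] y)) (h P Q)

/-- `(M* ⊗ N*)* = lim (𝓐ᵢ* ⊗ 𝓑ⱼ*)*`. -/
lemma exists_ctensor_quot (hM : (bidual M).IsIso) (hN : (bidual N).IsIso)
    (ha : IsProquasiCoherent a) (hb : IsProquasiCoherent b) {S : CommAlgCat.{u} R}
    (y : ∀ (P : QCohAlgQuot a) (Q : QCohAlgQuot b), (ctensor (qcoh R P.A) (qcoh R Q.A)).obj S)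
    (hy : ∀ (P P' : QCohAlgQuot a) (f : P.A →ₐ[R] P'.A) (Q Q' : QCohAlgQuot b)
      (g : Q.A →ₐ[R] Q'.A), P.IsMor P' f → Q.IsMor Q' g →
        (ctensorMap (qcohMap f.toLinearMap) (qcohMap g.toLinearMap)).app S (y P Q) = y P' Q') :
    ∃ s : (ctensor M N).obj S, ∀ (P : QCohAlgQuot a) (Q : QCohAlgQuot b),
      (ctensorMap P.proj Q.proj).app S s = y P Q := by
  have h1 : ∀ Q : QCohAlgQuot b, ∃ s : (dual (tensor (dual M) (dual (qcoh R Q.A)))).obj S,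
      ∀ P : QCohAlgQuot a, (restrictLeft (dualMap P.proj) _).app S s = y P Q := fun Q => by
    refine exists_bilin_quot hM ha (fun P => y P Q) fun P P' f hf => ?_
    have h := hy P P' f Q Q (AlgHom.id R Q.A) hf Q.isMor_id
    rw [AlgHom.toLinearMap_id, qcohMap_id_eq] at h
    exact h
  choose z hz using h1
  obtain ⟨s, hs⟩ := exists_bilin_quot hN hb
    (fun Q => (dualMap (tensorSwap (dual (qcoh R Q.A)) (dual M))).app S (z Q))
    fun Q Q' g hg => by
      -- The forms glued over P for each Q are compatible as Q varies, by uniqueness over P. They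
      -- can therefore be glued again over Q.
      have h2 : (dualMap (tensorMap (Hom.id (dual M)) (dualMap (qcohMap g.toLinearMap)))).app S
          (z Q) = z Q' := by
        refine bilin_quot_ext hM ha fun P => ?_
        rw [hz]
        have h := hy P P (AlgHom.id R P.A) Q Q' g P.isMor_id hg
        rw [AlgHom.toLinearMap_id, qcohMap_id_eq, ← hz Q P] at h
        rw [← h]
        exact tensor_dual_ext fun T φ x y => rfl
      rw [← h2]
      exact tensor_dual_ext fun T φ x y => rfl
  refine ⟨(dualMap (tensorSwap (dual M) (dual N))).app S s, fun P Q => ?_⟩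
  rw [← hz]
  refine tensor_dual_ext fun T φ x y => ?_
  exact congrArg (fun r => ev _ T ((dual (tensor (dual (qcoh R Q.A)) (dual M))).map φ r)
    (y ⊗ₜ[T] (dualMap P.proj).app T x)) (hs Q)

/-! ### Gluing the products of the 𝓐ᵢ ⊗ 𝓑ⱼ. -/

/-- The projection `M ⊗~ N → 𝓐ᵢ ⊗ 𝓑ⱼ`. -/
def ctensorProj (P : QCohAlgQuot a) (Q : QCohAlgQuot b) :
    Hom (ctensor M N) (tensor (qcoh R P.A) (qcoh R Q.A)) :=
  ((toCtensor (qcoh R P.A) (qcoh R Q.A)).inv (toCtensor_qcoh_isIso P.A Q.A)).comp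
    (ctensorMap P.proj Q.proj)

lemma toCtensor_ctensorProj (P : QCohAlgQuot a) (Q : QCohAlgQuot b) {S : CommAlgCat.{u} R}
    (s : (ctensor M N).obj S) :
    (toCtensor (qcoh R P.A) (qcoh R Q.A)).app S ((ctensorProj P Q).app S s) =
      (ctensorMap P.proj Q.proj).app S s := by
  rw [ctensorProj, Hom.comp_app, Hom.app_inv_app]

/-- This makes the projections of an element a compatible family. Transition maps being
multiplicative, the products of two such families are compatible too, and hence glue. -/
lemma tensorMap_ctensorProj {P P' : QCohAlgQuot a} {f : P.A →ₐ[R] P'.A} {Q Q' : QCohAlgQuot b}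
    {g : Q.A →ₐ[R] Q'.A} (hf : P.IsMor P' f) (hg : Q.IsMor Q' g) {S : CommAlgCat.{u} R}
    (s : (ctensor M N).obj S) :
    (tensorMap (qcohMap f.toLinearMap) (qcohMap g.toLinearMap)).app S ((ctensorProj P Q).app S s) =
      (ctensorProj P' Q').app S s := by
  refine (toCtensor_qcoh_isIso P'.A Q'.A S).1 ?_
  rw [← toCtensor_naturality, toCtensor_ctensorProj, toCtensor_ctensorProj, ← hf, ← hg]
  exact tensor_dual_ext fun T φ x y => rfl

/-- The algebra structure of `M ⊗~ N`. -/
lemma exists_isCtensorAlg (hM : (bidual M).IsIso) (hN : (bidual N).IsIso)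
    (ha : IsProquasiCoherent a) (hb : IsProquasiCoherent b) :
    ∃ t : AlgStr (ctensor M N), IsCtensorAlg a b t := by
  have hex : ∀ (S : CommAlgCat.{u} R) (x : ∀ p : QCohAlgQuot a × QCohAlgQuot b,
      (tensor (qcoh R p.1.A) (qcoh R p.2.A)).obj S),
      (∀ (P P' : QCohAlgQuot a) (f : P.A →ₐ[R] P'.A) (Q Q' : QCohAlgQuot b)
        (g : Q.A →ₐ[R] Q'.A), P.IsMor P' f → Q.IsMor Q' g →
        (tensorMap (qcohMap f.toLinearMap) (qcohMap g.toLinearMap)).app S (x (P, Q)) =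
          x (P', Q')) →
      ∃ s : (ctensor M N).obj S, ∀ p, (ctensorProj p.1 p.2).app S s = x p := fun S x hx => by
    obtain ⟨s, hs⟩ := exists_ctensor_quot hM hN ha hb
      (fun P Q => (toCtensor (qcoh R P.A) (qcoh R Q.A)).app S (x (P, Q)))
      fun P P' f Q Q' g hf hg => by
        rw [toCtensor_naturality, hx P P' f Q Q' g hf hg]
    refine ⟨s, fun p => (toCtensor_qcoh_isIso p.1.A p.2.A S).1 ?_⟩
    rw [toCtensor_ctensorProj, hs]
  obtain ⟨t, ht⟩ := exists_algStr_of_family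
    (fun p : QCohAlgQuot a × QCohAlgQuot b => qcohTensorAlg R p.1.A p.2.A)
    (fun p => ctensorProj p.1 p.2)
    (fun S s t h => ctensor_quot_ext hM hN ha hb fun P Q => by
      rw [← toCtensor_ctensorProj, ← toCtensor_ctensorProj, h (P, Q)])
    (fun S s t => hex S _ fun P P' f Q Q' g hf hg => by
      rw [(isAlgHom_tensorMap_qcohMap f g).map_mul, tensorMap_ctensorProj hf hg,
        tensorMap_ctensorProj hf hg])
    (fun S => hex S _ fun P P' f Q Q' g hf hg => (isAlgHom_tensorMap_qcohMap f g).map_one S)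
  exact ⟨t, fun P Q => ⟨ctensorProj P Q, Hom.ext_app fun S s => toCtensor_ctensorProj P Q s,
    ht (P, Q)⟩⟩

end Limit

/-! ### The multiplication of the completed tensor product in coordinates -/

section Coordinates

lemma IsCtensorAlg.exists_proj {M N : ModFun.{u, v} R} {a : AlgStr M} {b : AlgStr N}
    {t : AlgStr (ctensor M N)} (ht : IsCtensorAlg a b t) (P : QCohAlgQuot a)
    (Q : QCohAlgQuot b) :
    ∃ π : Hom (ctensor M N) (tensor (qcoh R P.A) (qcoh R Q.A)),
      IsAlgHom t (qcohTensorAlg R P.A Q.A) π ∧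
      (∀ S s, (ctensorMap P.proj Q.proj).app S s = (toCtensor _ _).app S (π.app S s)) ∧
      ∀ S (x : M.obj S) (y : N.obj S), π.app S ((toCtensor M N).app S (x ⊗ₜ[S] y)) =
        P.proj.app S x ⊗ₜ[S] Q.proj.app S y := by
  obtain ⟨π, hπ, h⟩ := ht P Q
  have h1 : ∀ S s, (ctensorMap P.proj Q.proj).app S s = (toCtensor _ _).app S (π.app S s) :=
    fun S s => (Hom.congr_app hπ S s).symm
  refine ⟨π, h, h1, fun S x y => (toCtensor_qcoh_isIso P.A Q.A S).1 ?_⟩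
  exact (h1 S _).symm.trans (toCtensor_naturality P.proj Q.proj (x ⊗ₜ[S] y))

variable {M N : ModFun.{u, v} R} {a : AlgStr M} {b : AlgStr N} {t : AlgStr (ctensor M N)}

/-- It suffices to project to each 𝓐ᵢ ⊗ 𝓑ⱼ, where the product is that of a tensor product of
algebras. -/
lemma IsCtensorAlg.mul_toCtensor (ht : IsCtensorAlg a b t) (hM : (bidual M).IsIso)
    (hN : (bidual N).IsIso) (ha : IsProquasiCoherent a) (hb : IsProquasiCoherent b)
    {S : CommAlgCat.{u} R} (x x' : M.obj S) (y y' : N.obj S) :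
    t.mul S ((toCtensor M N).app S (x ⊗ₜ[S] y)) ((toCtensor M N).app S (x' ⊗ₜ[S] y')) =
      (toCtensor M N).app S (a.mul S x x' ⊗ₜ[S] b.mul S y y') := by
  refine ctensor_quot_ext hM hN ha hb fun P Q => ?_
  obtain ⟨π, h, h1, h2⟩ := ht.exists_proj P Q
  refine (h1 S _).trans (Eq.trans ?_ (h1 S _).symm)
  refine congrArg ((toCtensor (qcoh R P.A) (qcoh R Q.A)).app S) ?_
  refine (h.map_mul S _ _).trans ((congrArg₂ (fun u v => (qcohTensorAlg R P.A Q.A).mul S u v)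
    (h2 S x y) (h2 S x' y')).trans (Eq.trans ?_ (h2 S _ _).symm))
  refine Eq.trans ?_ (congrArg₂ (fun x y => x ⊗ₜ[S] y) (P.isAlgHom.map_mul S x x').symm
    (Q.isAlgHom.map_mul S y y').symm)
  exact Algebra.TensorProduct.tmul_mul_tmul (A := S ⊗[R] P.A) (B := S ⊗[R] Q.A) _ _ _ _

lemma IsCtensorAlg.one_eq (ht : IsCtensorAlg a b t) (hM : (bidual M).IsIso)
    (hN : (bidual N).IsIso) (ha : IsProquasiCoherent a) (hb : IsProquasiCoherent b)
    (S : CommAlgCat.{u} R) :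
    t.one S = (toCtensor M N).app S (a.one S ⊗ₜ[S] b.one S) := by
  refine ctensor_quot_ext hM hN ha hb fun P Q => ?_
  obtain ⟨π, h, h1, h2⟩ := ht.exists_proj P Q
  refine (h1 S _).trans (Eq.trans ?_ (h1 S _).symm)
  refine congrArg ((toCtensor (qcoh R P.A) (qcoh R Q.A)).app S) ?_
  refine (h.map_one S).trans (Eq.trans ?_ (h2 S _ _).symm)
  exact (congrArg₂ (fun (x : S ⊗[R] P.A) (y : S ⊗[R] Q.A) => x ⊗ₜ[S] y) (P.isAlgHom.map_one S) (Q.isAlgHom.map_one S)).symm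

variable {J K : Type u} (E : Frame M J) (F : Frame N K)

/-- The frame of `M ⊗~ N`. -/
def Frame.ctensor : Frame (ctensor M N) (J × K) :=
  (E.dualFrame.tensor F.dualFrame).dualFrame

lemma Frame.coef_ctensor {S : CommAlgCat.{u} R} (p : J × K) (s : (RFunctor.ctensor M N).obj S) :
    coef (E.ctensor F).coord p s = ev (RFunctor.tensor (dual M) (dual N)) S s
      (E.dualFrame.vec S p.1 ⊗ₜ[S] F.dualFrame.vec S p.2) :=
  (E.dualFrame.tensor F.dualFrame).coef_dualFrame s p

lemma Frame.ctensor_vec (S : CommAlgCat.{u} R) (p : J × K) :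
    (E.ctensor F).vec S p = (toCtensor M N).app S (E.vec S p.1 ⊗ₜ[S] F.vec S p.2) := by
  refine ((E.dualFrame.tensor F.dualFrame).dualFrame_vec S p).trans
    ((E.dualFrame.tensor F.dualFrame).dual_ext fun q => ?_)
  refine (coef_tensorCoord _ _ p _ _).trans (Eq.trans ?_ (ev_toCtensor _ _ _ _).symm)
  rw [E.coef_dualFrame, F.coef_dualFrame]

/-- For fixed f ⊗ g, the value of s s' at f ⊗ g is a functional on two copies of M ⊗~ N, so the
tensor expansion of frames applies. The product is thereby reduced to the vectors e_i ⊗ e_k, where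
it is componentwise. -/
lemma IsCtensorAlg.ev_mul (ht : IsCtensorAlg a b t) (hM : (bidual M).IsIso)
    (hN : (bidual N).IsIso) (ha : IsProquasiCoherent a) (hb : IsProquasiCoherent b)
    {S : CommAlgCat.{u} R} (s s' : (ctensor M N).obj S) (f : (dual M).obj S)
    (g : (dual N).obj S) :
    ev (tensor (dual M) (dual N)) S (t.mul S s s') (f ⊗ₜ[S] g) =
      ∑ᶠ p : (J × K) × (J × K),
        (ev (tensor (dual M) (dual N)) S s
            (E.dualFrame.vec S p.1.1 ⊗ₜ[S] F.dualFrame.vec S p.1.2) *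
          ev (tensor (dual M) (dual N)) S s'
            (E.dualFrame.vec S p.2.1 ⊗ₜ[S] F.dualFrame.vec S p.2.2)) *
        (ev M S f (a.mul S (E.vec S p.1.1) (E.vec S p.2.1)) *
          ev N S g (b.mul S (F.vec S p.1.2) (F.vec S p.2.2))) := by
  have h := (E.ctensor F).ev_tensor_eq (E.ctensor F) ((dualMap t.mulHom).app S
    ((bidual (tensor (dual M) (dual N))).app S (f ⊗ₜ[S] g))) s s'
  have h1 : ∀ s s' : (ctensor M N).obj S, ev (tensor (ctensor M N) (ctensor M N)) S
      ((dualMap t.mulHom).app S ((bidual (tensor (dual M) (dual N))).app S (f ⊗ₜ[S] g)))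
        (s ⊗ₜ[S] s') = ev (tensor (dual M) (dual N)) S (t.mul S s s') (f ⊗ₜ[S] g) :=
    fun s s' => (ev_dualMap _ _ _).trans (ev_bidual _ _)
  rw [h1] at h
  refine h.trans (finsum_congr fun p => ?_)
  rw [h1, E.coef_ctensor, E.coef_ctensor, E.ctensor_vec, E.ctensor_vec,
    ht.mul_toCtensor hM hN ha hb]
  exact congrArg (fun u => _ * u) (ev_toCtensor _ _ _ _)

end Coordinates

/-! ### Bialgebras -/

section Bialgebras

/-- The compatibility of two algebra structures on `M` and `M*`, in coordinates. -/
structure Compatible {M : ModFun.{u, v} R} {J : Type u} (E : Frame M J) (a : AlgStr M)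
    (d : AlgStr (dual M)) : Prop where
  mul_mul : ∀ (S : CommAlgCat.{u} R) (x y : M.obj S) (f g : (dual M).obj S),
    ev M S (d.mul S f g) (a.mul S x y) = ∑ᶠ p : (J × J) × (J × J),
      (ev M S (d.mul S (E.dualFrame.vec S p.1.1) (E.dualFrame.vec S p.1.2)) x *
        ev M S (d.mul S (E.dualFrame.vec S p.2.1) (E.dualFrame.vec S p.2.2)) y) *
      (ev M S f (a.mul S (E.vec S p.1.1) (E.vec S p.2.1)) *
        ev M S g (a.mul S (E.vec S p.1.2) (E.vec S p.2.2)))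
  mul_one : ∀ (S : CommAlgCat.{u} R) (f g : (dual M).obj S),
    ev M S (d.mul S f g) (a.one S) = ev M S f (a.one S) * ev M S g (a.one S)
  one_mul : ∀ (S : CommAlgCat.{u} R) (x y : M.obj S),
    ev M S (d.one S) (a.mul S x y) = ev M S (d.one S) x * ev M S (d.one S) y
  one_one : ∀ S : CommAlgCat.{u} R, ev M S (d.one S) (a.one S) = 1

variable {M : ModFun.{u, v} R} {J : Type u} {E : Frame M J} {a : AlgStr M} {d : AlgStr (dual M)}

/-- This removes the structure `t` from the bialgebra axioms, leaving identities that mention only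
the pairing of M with M*. -/
lemma compatible_iff (E : Frame M J) (hM : (bidual M).IsIso) (ha : IsProquasiCoherent a)
    {t : AlgStr (ctensor M M)} (ht : IsCtensorAlg a a t) :
    Compatible E a d ↔ IsAlgHom a t (comul d) ∧ IsAlgHom a (unitAlg R) (counit d) := by
  have hmul : ∀ (S : CommAlgCat.{u} R) (x y : M.obj S) (f g : (dual M).obj S),
      ev (tensor (dual M) (dual M)) S (t.mul S ((comul d).app S x) ((comul d).app S y))
        (f ⊗ₜ[S] g) = ∑ᶠ p : (J × J) × (J × J),
      (ev M S (d.mul S (E.dualFrame.vec S p.1.1) (E.dualFrame.vec S p.1.2)) x *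
        ev M S (d.mul S (E.dualFrame.vec S p.2.1) (E.dualFrame.vec S p.2.2)) y) *
      (ev M S f (a.mul S (E.vec S p.1.1) (E.vec S p.2.1)) *
        ev M S g (a.mul S (E.vec S p.1.2) (E.vec S p.2.2))) := fun S x y f g => by
    rw [ht.ev_mul E E hM hM ha ha]
    refine finsum_congr fun p => ?_
    rw [ev_comul, ev_comul]
  have hone : ∀ (S : CommAlgCat.{u} R) (f g : (dual M).obj S),
      ev (tensor (dual M) (dual M)) S (t.one S) (f ⊗ₜ[S] g) =
        ev M S f (a.one S) * ev M S g (a.one S) := fun S f g => by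
    rw [ht.one_eq hM hM ha ha]
    exact ev_toCtensor _ _ _ _
  constructor
  · intro h
    refine ⟨⟨fun S x y => tensor_dual_ext fun T φ f g => ?_,
      fun S => tensor_dual_ext fun T φ f g => ?_⟩, ⟨fun S x y => ?_, fun S => ?_⟩⟩
    · have e1 : (ctensor M M).map φ ((comul d).app S (a.mul S x y)) =
          (comul d).app T (a.mul T (M.map φ x) (M.map φ y)) := by
        rw [← Hom.naturality, a.map_mul]
      have e2 : (ctensor M M).map φ (t.mul S ((comul d).app S x) ((comul d).app S y)) =
          t.mul T ((comul d).app T (M.map φ x)) ((comul d).app T (M.map φ y)) := by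
        rw [t.map_mul, ← Hom.naturality, ← Hom.naturality]
      refine (congrArg (fun s => ev (tensor (dual M) (dual M)) T s (f ⊗ₜ[T] g)) e1).trans
        (Eq.trans ?_ (congrArg (fun s => ev (tensor (dual M) (dual M)) T s (f ⊗ₜ[T] g)) e2).symm)
      exact (ev_comul d _ f g).trans ((h.mul_mul T _ _ f g).trans (hmul T _ _ f g).symm)
    · have e1 : (ctensor M M).map φ ((comul d).app S (a.one S)) = (comul d).app T (a.one T) := by
        rw [← Hom.naturality, a.map_one]
      refine (congrArg (fun s => ev (tensor (dual M) (dual M)) T s (f ⊗ₜ[T] g)) e1).trans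
        (Eq.trans ?_ (congrArg (fun s => ev (tensor (dual M) (dual M)) T s (f ⊗ₜ[T] g))
          (t.map_one φ)).symm)
      exact (ev_comul d _ f g).trans ((h.mul_one T f g).trans (hone T f g).symm)
    · rw [counit_app, counit_app, counit_app]
      exact h.one_mul S x y
    · rw [counit_app]
      exact h.one_one S
  · rintro ⟨h1, h2⟩
    refine ⟨fun S x y f g => ?_, fun S f g => ?_, fun S x y => ?_, fun S => ?_⟩
    · rw [← hmul, ← ev_comul, h1.map_mul]
    · rw [← hone, ← ev_comul, h1.map_one]
    · have h := h2.map_mul S x y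
      rw [counit_app, counit_app, counit_app] at h
      exact h
    · have h := h2.map_one S
      rw [counit_app] at h
      exact h

/-- The compatibility condition is symmetric. -/
lemma Compatible.dual (h : Compatible E a d) (hM : (bidual M).IsIso) :
    Compatible E.dualFrame d (a.transport (bidual M) hM) := by
  refine ⟨fun S f g F G => ?_, fun S F G => ?_, fun S f g => ?_, fun S => ?_⟩
  · obtain ⟨x, rfl⟩ := (hM S).2 F
    obtain ⟨y, rfl⟩ := (hM S).2 G
    simp only [E.dualFrame_dualFrame_vec, a.transport_mul, ev_bidual]
    -- Exchanging the inner indices, ((i, j), (k, l)) ↦ ((i, k), (j, l)), matches the two sums term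
    -- by term.
    rw [h.mul_mul, ← finsum_comp_equiv (Equiv.prodProdProdComm J J J J)]
    refine finsum_congr fun p => ?_
    simp only [Equiv.prodProdProdComm_apply]
    ring
  · obtain ⟨x, rfl⟩ := (hM S).2 F
    obtain ⟨y, rfl⟩ := (hM S).2 G
    rw [a.transport_mul, ev_bidual, ev_bidual, ev_bidual, h.one_mul]
  · refine (ev_bidual (a.one S) _).trans ((h.mul_one S f g).trans ?_)
    exact (congrArg₂ (· * ·) (ev_bidual (a.one S) f) (ev_bidual (a.one S) g)).symm
  · exact (ev_bidual (a.one S) _).trans (h.one_one S)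

lemma IsAlgHom.dualMap_dualMap {M : ModFun.{u, v} R} {N : ModFun.{u, w} R} {a : AlgStr M}
    {b : AlgStr N} {f : Hom M N} (h : IsAlgHom a b f) (hM : (bidual M).IsIso)
    (hN : (bidual N).IsIso) :
    IsAlgHom (a.transport (bidual M) hM) (b.transport (bidual N) hN) (dualMap (dualMap f)) where
  map_mul S F G := by
    obtain ⟨x, rfl⟩ := (hM S).2 F
    obtain ⟨y, rfl⟩ := (hM S).2 G
    rw [a.transport_mul, bidual_naturality, bidual_naturality, bidual_naturality, h.map_mul,
      b.transport_mul]
  map_one S := (bidual_naturality f (a.one S)).trans (congrArg ((bidual N).app S) (h.map_one S))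

/-- The triangle identity: the dual of M → M** composed with M* → M*** is the identity. -/
lemma dualMap_bidual {M : ModFun.{u, v} R} (h : (bidual (dual M)).IsIso) :
    dualMap (bidual M) = (bidual (dual M)).inv h :=
  Hom.ext_app fun S F => by
    obtain ⟨f, rfl⟩ := (h S).2 F
    rw [Hom.inv_app_app]
    exact dual_ext fun T φ x => by
      rw [← Hom.naturality, ← Hom.naturality, ev_dualMap, ev_bidual, ev_bidual]

lemma dualMap_bidual_inv {M : ModFun.{u, v} R} (h : (bidual M).IsIso) :
    dualMap ((bidual M).inv h) = bidual (dual M) :=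
  Hom.ext_app fun S f => dual_ext fun T φ F => by
    obtain ⟨x, rfl⟩ := (h T).2 F
    rw [← Hom.naturality, ← Hom.naturality, ev_dualMap, Hom.inv_app_app, ev_bidual, ev_bidual]

lemma isDual_dual (M : ModFun.{u, u + 1} R) : IsDual (dual M) :=
  ⟨M, Hom.id _, fun _ => Function.bijective_id⟩

/-! ### The duality functor and its equivalence property. -/

namespace Bialg

lemma bidual_isIso (B : Bialg R) : (bidual B.carrier).IsIso :=
  let ⟨_, ⟨E⟩⟩ := B.inF.exists_frame
  E.bidual_isIso B.inF.1

lemma bidual_dual_isIso (B : Bialg R) : (bidual (dual B.carrier)).IsIso :=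
  let ⟨_, ⟨E⟩⟩ := B.inF.exists_frame
  E.dualFrame.bidual_isIso (isDual_dual B.carrier)

lemma exists_compatible (B : Bialg R) :
    ∃ (J : Type u) (E : Frame B.carrier J), Compatible E B.alg B.dualAlg := by
  obtain ⟨J, ⟨E⟩⟩ := B.inF.exists_frame
  obtain ⟨t, ht, h⟩ := B.comul_isAlgHom
  exact ⟨J, E, (compatible_iff E B.bidual_isIso B.proquasiCoherent ht).2
    ⟨h, B.counit_isAlgHom⟩⟩

/-- The dual bialgebra. -/
def dualBialg (B : Bialg R) : Bialg R where
  carrier := dual B.carrier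
  alg := B.dualAlg
  dualAlg := B.alg.transport (bidual B.carrier) B.bidual_isIso
  inF := by
    obtain ⟨J, ⟨E⟩⟩ := B.inF.exists_frame
    exact E.dualFrame.inF (isDual_dual B.carrier)
  proquasiCoherent := B.dual_proquasiCoherent
  dual_proquasiCoherent := B.proquasiCoherent.of_isIso
    (B.alg.isAlgHom_transport (bidual B.carrier) B.bidual_isIso) B.bidual_isIso
  comul_isAlgHom := by
    obtain ⟨J, E, h⟩ := B.exists_compatible
    -- The axiom for 𝔹* refers to an algebra structure on 𝔹* ⊗~ 𝔹*, which has to be constructed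
    -- before the symmetric identities can be read back.
    obtain ⟨t, ht⟩ := exists_isCtensorAlg B.bidual_dual_isIso B.bidual_dual_isIso
      B.dual_proquasiCoherent B.dual_proquasiCoherent
    exact ⟨t, ht, ((compatible_iff E.dualFrame B.bidual_dual_isIso B.dual_proquasiCoherent ht).1
      (h.dual B.bidual_isIso)).1⟩
  counit_isAlgHom := by
    obtain ⟨J, E, h⟩ := B.exists_compatible
    obtain ⟨t, ht⟩ := exists_isCtensorAlg B.bidual_dual_isIso B.bidual_dual_isIso
      B.dual_proquasiCoherent B.dual_proquasiCoherent
    exact ((compatible_iff E.dualFrame B.bidual_dual_isIso B.dual_proquasiCoherent ht).1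
      (h.dual B.bidual_isIso)).2

variable (R) in
/-- The duality functor `𝔹 ↦ 𝔹*`, `f ↦ f*`. -/
def dualFunctor : (Bialg R)ᵒᵖ ⥤ Bialg R where
  obj B := dualBialg B.unop
  map f :=
    { hom := dualMap (Hom.hom f.unop)
      isAlgHom := Hom.dual_isAlgHom f.unop
      dual_isAlgHom := (Hom.isAlgHom f.unop).dualMap_dualMap (bidual_isIso _) (bidual_isIso _) }
  map_id _ := rfl
  map_comp _ _ := rfl

/-- A morphism of bialgebras which is an isomorphism of functors is an isomorphism. -/
lemma nonempty_iso {B C : Bialg R} (f : Bialg.Hom B C) (hf : f.hom.IsIso)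
    (g : Bialg.Hom C B) (hg : ∀ S x, g.hom.app S (f.hom.app S x) = x) : Nonempty (B ≅ C) :=
  ⟨{ hom := f
     inv := g
     hom_inv_id := Bialg.Hom.ext (RFunctor.Hom.ext_app hg)
     inv_hom_id := Bialg.Hom.ext (RFunctor.Hom.ext_app fun S y => by
      obtain ⟨x, rfl⟩ := (hf S).2 y
      exact congrArg (f.hom.app S) (hg S x)) }⟩

/-- The natural morphism `𝔹 → 𝔹**`. -/
def bidualHom (B : Bialg R) : Bialg.Hom B (dualBialg (dualBialg B)) where
  hom := bidual B.carrier
  isAlgHom := B.alg.isAlgHom_transport _ _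
  dual_isAlgHom := by
    have h : IsAlgHom (B.dualAlg.transport _ B.bidual_dual_isIso) B.dualAlg
        (dualMap (bidual B.carrier)) := by
      rw [dualMap_bidual B.bidual_dual_isIso]
      exact (B.dualAlg.isAlgHom_transport _ _).inv _
    exact h

/-- The inverse of `𝔹 → 𝔹**`. -/
def bidualInv (B : Bialg R) : Bialg.Hom (dualBialg (dualBialg B)) B where
  hom := (bidual B.carrier).inv B.bidual_isIso
  isAlgHom := (B.alg.isAlgHom_transport _ _).inv _
  dual_isAlgHom := by
    have h : IsAlgHom B.dualAlg (B.dualAlg.transport _ B.bidual_dual_isIso)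
        (dualMap ((bidual B.carrier).inv B.bidual_isIso)) := by
      rw [dualMap_bidual_inv]
      exact B.dualAlg.isAlgHom_transport _ _
    exact h

instance : (dualFunctor R).Faithful where
  map_injective {B C f g} h := by
    refine Quiver.Hom.unop_inj (Hom.ext (Hom.ext_app fun S x => ?_))
    have h' : dualMap (Hom.hom f.unop) = dualMap (Hom.hom g.unop) := congrArg Hom.hom h
    -- Followed by the injection into the bidual, a morphism equals its double dual after M → M**,
    -- which depends only on its dual.
    refine (B.unop.bidual_isIso S).1 ?_
    rw [← bidual_naturality, ← bidual_naturality, h']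

instance : (dualFunctor R).Full where
  map_surjective {B C} g := by
    let γ : RFunctor.Hom (dual B.unop.carrier) (dual C.unop.carrier) := Hom.hom g
    -- The preimage of γ is γ* read through the two reflexivity isomorphisms.
    let f : RFunctor.Hom C.unop.carrier B.unop.carrier :=
      ((bidual B.unop.carrier).inv B.unop.bidual_isIso).comp
        ((dualMap γ).comp (bidual C.unop.carrier))
    have hf : dualMap f = γ := Hom.ext_app fun S w => dual_ext fun T φ y => by
      rw [← Hom.naturality, ← Hom.naturality, ev_dualMap, ← ev_bidual]
      change ev _ T ((bidual B.unop.carrier).app T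
        (((bidual B.unop.carrier).inv B.unop.bidual_isIso).app T
          ((dualMap γ).app T ((bidual C.unop.carrier).app T y)))) _ = _
      rw [Hom.app_inv_app, ev_dualMap, ev_bidual]
    refine ⟨Quiver.Hom.op (?_ : Hom C.unop B.unop), ?_⟩
    · exact
        { hom := f
          isAlgHom := ((B.unop.alg.isAlgHom_transport _ _).inv _).comp
            ((Hom.dual_isAlgHom g).comp (C.unop.alg.isAlgHom_transport _ C.unop.bidual_isIso))
          dual_isAlgHom := by rw [hf]; exact Hom.isAlgHom g }
    · exact Hom.ext hf

instance : (dualFunctor R).EssSurj where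
  mem_essImage B := ⟨Opposite.op (dualBialg B), (nonempty_iso (bidualHom B) B.bidual_isIso (bidualInv B)
    fun _ x => Hom.inv_app_app _ B.bidual_isIso x).map Iso.symm⟩

instance : (dualFunctor R).IsEquivalence where

end Bialg

end Bialgebras

end RFunctor

end

theorem mainTheorem11 (R : Type u) [CommRing R] :
    ∃ (D : (RFunctor.Bialg R)ᵒᵖ ⥤ RFunctor.Bialg R)
      (e : ∀ B : RFunctor.Bialg R,
        RFunctor.Hom (D.obj (Opposite.op B)).carrier (RFunctor.dual B.carrier)),
      (∀ B : RFunctor.Bialg R, RFunctor.IsDualBialg B (D.obj (Opposite.op B)) (e B)) ∧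
      (∀ (B C : RFunctor.Bialg R) (f : B ⟶ C),
        (e B).comp (D.map f.op).hom = (RFunctor.dualMap f.hom).comp (e C)) ∧
      D.IsEquivalence := by
  -- The comparison is the identity because the carrier of the dual bialgebra is by definition the
  -- dual functor.
  refine ⟨RFunctor.Bialg.dualFunctor R, fun B => RFunctor.Hom.id _, fun B => ?_, fun B C f => rfl,
    inferInstance⟩
  exact ⟨fun _ => Function.bijective_id, .id _, B.bidual_isIso,
    B.alg.isAlgHom_transport _ B.bidual_isIso⟩
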